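/- **Setting.** Let $N,K,d\ge 1$ and $T\ge 0$ be integers and $\Pi=\{\pi:[N]\to[K]\}$. Contexts $\phi_t(i,a)\in\mathbb R^d$ with $\|\phi_t(i,a)\|_2\le 1$ ($t\in[T]$, $i\in[N]$, $a\in[K]$) are fixed in advance, and $\theta^*\in\mathbb R^d$ is an unknown parameter with $\|\theta^*\|_2\le D$, $D>0$. The feedback model is an exponential family: $\nu$ is a measure on $\mathbb R$ and $m:\mathbb R\to\mathbb R$ a function such that, for every $z\in\mathbb R$, $\mathbb P_z(dy)=\exp(yz-m(z))\,\nu(dy)$ is a probability measure; put $\mu=m'$. Assume that $\mu\ge 0$, that $\mu$ is differentiable and $L_\mu$-Lipschitz, and that $$\kappa_\mu=\inf\{\mu'(x^\top\theta):\|x\|_2\le 1,\ \|\theta-\theta^*\|_2\le D+1\}>0 .$$ Let $r:[0,\infty)\to[0,\infty)$ be concave, nondecreasing, $L_r$-Lipschitz and bounded by a constant $M$. For $\pi\in\Pi$ and $\theta\in\mathbb R^d$ put $f_t(\pi;\theta)=\sum_{a\in[K]} r\big(\sum_{i\in\pi^{-1}(a)}\mu(\phi_t(i,a)^\top\theta)\big)$.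 In round $t=1,\dots,T$ the learner chooses $\pi_t\in\Pi$ and then observes $y_t(1),\dots,y_t(N)$. Write $x_t(i)=\phi_t(i,\pi_t(i))$. Given the feedback of the earlier rounds and $\pi_1,\dots,\pi_t$, the variables $y_t(1),\dots,y_t(N)$ are independent, $y_t(i)$ has law $\mathbb P_{x_t(i)^\top\theta^*}$, and $y_t(i)-\mu(x_t(i)^\top\theta^*)$ is $\sigma$-sub-Gaussian for some $\sigma>0$, that is, $\mathbb E[e^{\xi(y_t(i)-\mu(x_t(i)^\top\theta^*))}\mid\cdot\,]\le e^{\xi^2\sigma^2/2}$ for all $\xi\in\mathbb R$. For $\alpha\in(0,1]$ the $\alpha$-approximate regret is $$\mathcal R_T^\alpha=\sum_{t=1}^T\Big(\alpha\max_{\pi\in\Pi} f_t(\pi;\theta^*)-f_t(\pi_t;\theta^*)\Big).$$ **Algorithm (CAB-UCB).** Let $\lambda_0,c_1>0$. In round $t$ let $V_t=\lambda_0 I+\sum_{s<t}\sum_{i=1}^N x_s(i)x_s(i)^\top$, let $\bar\theta_t$ be a minimizer over $\theta\in\mathbb R^d$ of $$\sum_{s<t}\sum_{i=1}^N\big(m(x_s(i)^\top\theta)-y_s(i)\,x_s(i)^\top\theta\big)+\tfrac{\kappa_\mu\lambda_0}{2}\|\theta\|_2^2,$$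 and let $\pi_t$ be the answer of an $\alpha$-approximate oracle, that is, with $g_t(\pi)=c_1\sum_{i=1}^N\|\phi_t(i,\pi(i))\|_{V_t^{-1}}$ and $\|v\|_A=\sqrt{v^\top Av}$, $$f_t(\pi_t;\bar\theta_t)+g_t(\pi_t)\ \ge\ \alpha\max_{\pi\in\Pi}\big(f_t(\pi;\bar\theta_t)+g_t(\pi)\big).$$ **Theorem.** Let $\delta\in(0,1)$. (1) Suppose that CAB-UCB is run with $$\lambda_0\ \ge\ \frac{\sigma^2}{\kappa_\mu^2}\Big(d\log\big(1+\tfrac{NT}{d}\big)+2\log\tfrac1\delta\Big),\qquad c_1=\frac{L_rL_\mu}{\kappa_\mu}\Big(\sigma\sqrt{d\log\big(1+\tfrac{NT}{d\lambda_0}\big)+2\log\tfrac1\delta}+\kappa_\mu D\sqrt{\lambda_0}\Big).$$ Then, with probability at least $1-2\delta$, $$\mathcal R_T^\alpha\ \le\ 2c_1\left(\sqrt{2dNT\log\big(1+\tfrac{NT}{d\lambda_0}\big)}+\frac{2dN}{\sqrt{\lambda_0}}\log\big(1+\tfrac{NT}{d\lambda_0}\big)\right).$$ (2) If $\lambda_0$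 equals its lower bound in (1), then $\mathcal R_T^\alpha=\tilde O\big(\kappa_\mu^{-1}L_rL_\mu D\,(d\sqrt{NT}+dN)\big)$ with probability at least $1-2\delta$. Precisely: for all $\sigma>0$ and $D_0>0$ there are $C>0$ and $p\in\mathbb N$, depending only on $\sigma$ and $D_0$, such that, whenever the sub-Gaussian parameter is $\sigma$ and $D\ge D_0$, with probability at least $1-2\delta$, $$\mathcal R_T^\alpha\ \le\ C\,\Big(\log\big(e+\tfrac{NT}{\delta}\big)\Big)^{p}\,\kappa_\mu^{-1}L_rL_\mu D\,\big(d\sqrt{NT}+dN\big).$$ -/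

import Mathlib

open MeasureTheory ProbabilityTheory
open scoped ENNReal NNReal

namespace CAB

/-- Feature space `ℝ^d` with the Euclidean norm. -/
abbrev Feat (d : ℕ) : Type := EuclideanSpace ℝ (Fin d)

/-- Allocations of the `N` users to the `K` arms. -/
abbrev Alloc (N K : ℕ) : Type := Fin N → Fin K

/-- Member with natural parameter `z` of the one-parameter exponential family with base measure `ν`
and log-partition function `m`: its density with respect to `ν` is `y ↦ exp (y z - m z)`. -/
noncomputable def glmLaw (ν : Measure ℝ) (m : ℝ → ℝ) (z : ℝ) : Measure ℝ :=
  ν.withDensity (fun y => ENNReal.ofReal (Real.exp (y * z - m z)))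

/-- The data of a combinatorial allocation bandit with `N` users, `K` arms and features in `ℝ^d`.
Rounds are numbered `0, …, T - 1`. The contexts are fixed in advance (oblivious adversary). -/
structure Problem (N K d : ℕ) where
  /-- number of rounds -/
  T : ℕ
  /-- base measure of the feedback model -/
  ν : Measure ℝ
  /-- log-partition function of the feedback model -/
  m : ℝ → ℝ
  /-- satisfaction function, used on `[0, ∞)` only -/
  r : ℝ → ℝ
  /-- upper bound of the satisfaction function -/
  M : ℝ
  /-- contexts -/
  φ : ℕ → Fin N → Fin K → Feat d
  /-- unknown parameter -/
  θstar : Feat d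
  /-- bound on the norm of the unknown parameter -/
  D : ℝ
  /-- sub-Gaussian parameter of the noise -/
  σ : ℝ
  /-- Lipschitz constant of the satisfaction function -/
  Lr : ℝ≥0
  /-- Lipschitz constant of the mean function -/
  Lμ : ℝ≥0

variable {N K d : ℕ}

namespace Problem

/-- Mean function (inverse link) `μ = m'`. -/
noncomputable def μ (B : Problem N K d) : ℝ → ℝ := deriv B.m

/-- `κ_μ`, the infimum of `μ'(xᵀθ)` over `‖x‖ ≤ 1` and `‖θ - θ*‖ ≤ D + 1`. -/
noncomputable def κ (B : Problem N K d) : ℝ :=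
  sInf {k : ℝ | ∃ x θ : Feat d, ‖x‖ ≤ 1 ∧ ‖θ - B.θstar‖ ≤ B.D + 1 ∧
    k = deriv B.μ (inner ℝ x θ)}

/-- Standing assumptions on the problem data. The first one says that the feedback model is a
generalized linear model; it makes `m` smooth, with `m' z` and `m'' z` the mean and the variance of
`glmLaw ν m z`. -/
structure IsAdmissible (B : Problem N K d) : Prop where
  glm : ∀ z : ℝ, IsProbabilityMeasure (glmLaw B.ν B.m z)
  mu_differentiable : Differentiable ℝ B.μ
  mu_lipschitz : LipschitzWith B.Lμ B.μ
  mu_nonneg : ∀ z : ℝ, 0 ≤ B.μ z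
  kappa_pos : 0 < B.κ
  r_nonneg : ∀ u : ℝ, 0 ≤ u → 0 ≤ B.r u
  r_le : ∀ u : ℝ, 0 ≤ u → B.r u ≤ B.M
  r_concave : ConcaveOn ℝ (Set.Ici 0) B.r
  r_monotone : MonotoneOn B.r (Set.Ici 0)
  r_lipschitz : LipschitzOnWith B.Lr B.r (Set.Ici 0)
  context_norm_le : ∀ t < B.T, ∀ i a, ‖B.φ t i a‖ ≤ 1
  D_pos : 0 < B.D
  theta_norm_le : ‖B.θstar‖ ≤ B.D
  sigma_pos : 0 < B.σ

/-- The total satisfaction `f_t(π; θ) = ∑_a r (∑_{i ∈ π⁻¹(a)} μ (φ_t(i,a)ᵀ θ))`. -/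
noncomputable def f (B : Problem N K d) (t : ℕ) (π : Alloc N K) (θ : Feat d) : ℝ :=
  ∑ a : Fin K, B.r (∑ i with π i = a, B.μ (inner ℝ (B.φ t i a) θ))

/-- The `α`-approximate regret of a sequence of allocations:
`∑_t (α max_π f_t(π; θ*) - f_t(π_t; θ*))`. -/
noncomputable def regret (B : Problem N K d) (α : ℝ) (π : ℕ → Alloc N K) : ℝ :=
  ∑ t ∈ Finset.range B.T,
    (α * (⨆ π' : Alloc N K, B.f t π' B.θstar) - B.f t (π t) B.θstar)

/-- `x_t(i) = φ_t(i, π_t(i))`, the feature that user `i` is given in round `t`. -/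
def x (B : Problem N K d) (π : ℕ → Alloc N K) (t : ℕ) (i : Fin N) : Feat d :=
  B.φ t i (π t i)

/-- `V_t = λ₀ I + ∑_{s<t} ∑_i x_s(i) x_s(i)ᵀ`. -/
noncomputable def V (B : Problem N K d) (lam0 : ℝ) (π : ℕ → Alloc N K) (t : ℕ) :
    Matrix (Fin d) (Fin d) ℝ :=
  lam0 • (1 : Matrix (Fin d) (Fin d) ℝ) +
    ∑ s ∈ Finset.range t, ∑ i, Matrix.vecMulVec (B.x π s i).ofLp (B.x π s i).ofLp

/-- Negative log-likelihood (up to an additive constant) of the observations of the rounds before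
`t`, plus the ridge penalty `(lam / 2) ‖θ‖²`. -/
noncomputable def loss (B : Problem N K d) (lam : ℝ) (π : ℕ → Alloc N K) (y : ℕ → Fin N → ℝ)
    (t : ℕ) (θ : Feat d) : ℝ :=
  (∑ s ∈ Finset.range t, ∑ i,
      (B.m (inner ℝ (B.x π s i) θ) - y s i * inner ℝ (B.x π s i) θ)) + lam / 2 * ‖θ‖ ^ 2

end Problem

/-- The weighted norm `‖v‖_A = √(vᵀ A v)`. -/
noncomputable def wnorm (A : Matrix (Fin d) (Fin d) ℝ) (v : Feat d) : ℝ :=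
  Real.sqrt (v.ofLp ⬝ᵥ (A.mulVec v.ofLp))

/-- The objective that the oracle maximizes:
`∑_a r (∑_{i ∈ π⁻¹(a)} v_i(a)) + ∑_i w_i(π(i))`. -/
noncomputable def oracleObjective (r : ℝ → ℝ) (v w : Fin N → Fin K → ℝ) (π : Alloc N K) : ℝ :=
  (∑ a : Fin K, r (∑ i with π i = a, v i a)) + ∑ i, w i (π i)

/-- `π` is an answer that an `α`-approximate oracle may return on the input `(v, w)`. -/
def IsOracleAnswer (r : ℝ → ℝ) (α : ℝ) (v w : Fin N → Fin K → ℝ) (π : Alloc N K) : Prop :=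
  α * (⨆ π' : Alloc N K, oracleObjective r v w π') ≤ oracleObjective r v w π

/-- Information available when the feedback of round `t` is drawn: the feedback of all the rounds
before `t` and the allocations of all the rounds up to and including `t`. -/
@[reducible] def info {Ω : Type*} (π : ℕ → Ω → Alloc N K) (y : ℕ → Fin N → Ω → ℝ) (t : ℕ) :
    MeasurableSpace Ω :=
  MeasurableSpace.comap
    (fun ω => ((fun (s : Fin t) (i : Fin N) => y s i ω), (fun s : Fin (t + 1) => π s ω)))
    inferInstance

/-- The feedback mechanism. In each round, given the past and the chosen allocation, the feedback
of the different users is independent, the one of user `i` has the law of the generalized linear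
model with parameter `x_t(i)ᵀ θ*`, and its deviation from the mean is `σ`-sub-Gaussian. -/
structure IsFeedback (B : Problem N K d) {Ω : Type*} [MeasurableSpace Ω] (P : Measure Ω)
    (π : ℕ → Ω → Alloc N K) (y : ℕ → Fin N → Ω → ℝ) : Prop where
  measurable_alloc : ∀ t, Measurable (π t)
  measurable_feedback : ∀ t i, Measurable (y t i)
  law : ∀ t < B.T, ∀ S : Fin N → Set ℝ, (∀ i, MeasurableSet (S i)) →
    P[{ω | ∀ i, y t i ω ∈ S i}.indicator (fun _ => (1 : ℝ)) | info π y t] =ᵐ[P]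
      fun ω => ∏ i, (glmLaw B.ν B.m
        (inner ℝ (B.x (fun s => π s ω) t i) B.θstar)).real (S i)
  subGaussian : ∀ t < B.T, ∀ i, ∀ ξ : ℝ,
    Integrable (fun ω => Real.exp (ξ * (y t i ω -
      B.μ (inner ℝ (B.x (fun s => π s ω) t i) B.θstar)))) P ∧
    P[fun ω => Real.exp (ξ * (y t i ω -
      B.μ (inner ℝ (B.x (fun s => π s ω) t i) B.θstar))) | info π y t] ≤ᵐ[P]
      fun _ => Real.exp (ξ ^ 2 * B.σ ^ 2 / 2)

/-- A run of the algorithm CAB-UCB with regularization `lam0`, exploration constant `c₁` and an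
`α`-approximate oracle: in each round the estimate `θbar t` minimizes the ridge-penalized negative
log-likelihood with penalty `κ lam0`, and the allocation is an answer of the oracle to the
maximization of `f_t(π; θbar t) + c₁ ∑_i ‖φ_t(i, π(i))‖_{V_t⁻¹}`. -/
structure IsUCBRun (B : Problem N K d) (lam0 c₁ α : ℝ) {Ω : Type*} [MeasurableSpace Ω]
    (P : Measure Ω) (π : ℕ → Ω → Alloc N K) (y : ℕ → Fin N → Ω → ℝ)
    (θbar : ℕ → Ω → Feat d) : Prop extends IsFeedback B P π y where
  mle : ∀ t < B.T, ∀ ω, ∀ θ : Feat d,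
    B.loss (B.κ * lam0) (fun s => π s ω) (fun s i => y s i ω) t (θbar t ω) ≤
      B.loss (B.κ * lam0) (fun s => π s ω) (fun s i => y s i ω) t θ
  oracle : ∀ t < B.T, ∀ ω,
    IsOracleAnswer B.r α
      (fun i a => B.μ (inner ℝ (B.φ t i a) (θbar t ω)))
      (fun i a => c₁ * wnorm (B.V lam0 (fun s => π s ω) t)⁻¹ (B.φ t i a))
      (π t ω)

/-- The least admissible regularization
`(σ² / κ²) (d log (1 + N T / d) + 2 log (1 / δ))`. -/
noncomputable def lamMin (B : Problem N K d) (δ : ℝ) : ℝ :=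
  B.σ ^ 2 / B.κ ^ 2 * (d * Real.log (1 + N * B.T / d) + 2 * Real.log (1 / δ))

/-- The exploration constant
`(L_r L_μ / κ) (σ √(d log (1 + N T / (d λ₀)) + 2 log (1 / δ)) + κ D √λ₀)`. -/
noncomputable def explConst (B : Problem N K d) (lam0 δ : ℝ) : ℝ :=
  B.Lr * B.Lμ / B.κ *
    (B.σ * Real.sqrt (d * Real.log (1 + N * B.T / (d * lam0)) + 2 * Real.log (1 / δ)) +
      B.κ * B.D * Real.sqrt lam0)

end CAB

/-!
The regret of CAB-UCB is bounded by optimism: if in every round the estimator lies in an ellipsoid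
around `θ*` in the norm of `V_t`, then the bonus `c₁ ∑_i ‖φ_t(i, π(i))‖_{V_t⁻¹}` dominates the error
of the plug-in objective, uniformly in the allocation. The regret of the round is then at most twice
the bonus of the chosen allocation (`mul_iSup_f_sub_le`), and the bonuses are summed by a
determinant argument (`sum_wnorm_le`).

*Noise.* By the law of the feedback, the noise of a round is a vector of independent sub-Gaussian
variables once the allocation is fixed (`IsFeedback.map_restrict_eq`, `IsFeedback.cgf_le`). Hence
`exp (ξᵀ S_t - (σ² / 2) ∑ (ξᵀ x_s(i))²)` is a supermartingale for every `ξ ∈ ℝ^d`, where `S_t` is the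
noise sum. Mixing over a Gaussian `ξ` of precision proportional to `λ` and applying Ville's inequality
gives, for every `λ > 0`, a bound for `S_t` in the norm of `(λ I + ∑ x xᵀ)⁻¹` that holds for all
rounds simultaneously with probability at least `1 - δ` (`measure_noiseSum_gt_le`). It is used for
`λ = 1` and for `λ = λ₀`, hence the probability `1 - 2 δ`.

*Estimation.* The link function has slope at least `κ` on the interval of radius `‖θ*‖ + D + 1` only,
and is merely nondecreasing elsewhere, so strong convexity of the loss is available at the estimator
only if no past feature sees a deviation `|xᵀ (θbar - θ*)|` above `D + 1`. If one did, take the point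
`v` of the segment at which the largest deviation seen equals `D + 1`. Then both `∑ (xᵀ v)²` and
`‖v‖²` are at least `(D + 1)²`, and the first-order condition contradicts the noise bound with `λ = 1`
as soon as `λ₀` exceeds its lower bound (`abs_inner_sub_le`); no comparison of `λ₀` with `1` is
needed. The noise bound with `λ = λ₀` then gives the ellipsoid (`sqrt_quadratic_sub_le`).

*Rate.* For the least `λ₀` the explicit bound involves `1 / √λ₀`, which is proportional to `κ`. It is
under control because `κ ≤ σ²` (`IsFeedback.kappa_le_sq`): the curvature of the log-partition function
is the variance of the feedback, and the variance is at most the sub-Gaussian parameter squared.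
-/

/-! ### Exponential families -/

namespace CAB

section GLM

variable {ν : Measure ℝ} {m : ℝ → ℝ}

lemma lintegral_exp_mul_of_glmLaw (h : ∀ z, IsProbabilityMeasure (glmLaw ν m z)) (z : ℝ) :
    ∫⁻ y, ENNReal.ofReal (Real.exp (y * z)) ∂ν = ENNReal.ofReal (Real.exp (m z)) := by
  have h1 := (h z).measure_univ
  rw [glmLaw, withDensity_apply _ MeasurableSet.univ, Measure.restrict_univ] at h1
  have h2 : ∀ y : ℝ, ENNReal.ofReal (Real.exp (y * z)) =
      ENNReal.ofReal (Real.exp (m z)) * ENNReal.ofReal (Real.exp (y * z - m z)) := fun y => by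
    rw [← ENNReal.ofReal_mul (Real.exp_pos _).le, ← Real.exp_add]
    congr 2; ring
  simp_rw [h2]
  rw [lintegral_const_mul _ (by fun_prop), h1, mul_one]

lemma integrable_exp_mul_of_glmLaw (h : ∀ z, IsProbabilityMeasure (glmLaw ν m z)) (z : ℝ) :
    Integrable (fun y => Real.exp (z * id y)) ν := by
  refine ⟨by fun_prop, ?_⟩
  rw [hasFiniteIntegral_iff_ofReal (ae_of_all _ fun y => (Real.exp_pos _).le)]
  simp_rw [id, mul_comm z, lintegral_exp_mul_of_glmLaw h z]
  exact ENNReal.ofReal_lt_top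

/-- The normalization of the family forces the log-partition function to be the cumulant generating
function of the base measure. -/
lemma eq_cgf_of_glmLaw (h : ∀ z, IsProbabilityMeasure (glmLaw ν m z)) : m = cgf id ν := by
  funext z
  have h1 : mgf id ν z = Real.exp (m z) := by
    rw [mgf, integral_eq_lintegral_of_nonneg_ae (ae_of_all _ fun y => (Real.exp_pos _).le)
      (integrable_exp_mul_of_glmLaw h z).1]
    simp_rw [id, mul_comm z, lintegral_exp_mul_of_glmLaw h z]
    exact ENNReal.toReal_ofReal (Real.exp_pos _).le
  rw [cgf, h1, Real.log_exp]

lemma integrableExpSet_of_glmLaw (h : ∀ z, IsProbabilityMeasure (glmLaw ν m z)) (z : ℝ) :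
    z ∈ interior (integrableExpSet id ν) := by
  have : integrableExpSet id ν = Set.univ :=
    Set.eq_univ_of_forall fun z => integrable_exp_mul_of_glmLaw h z
  simp [this]

lemma differentiable_of_glmLaw (h : ∀ z, IsProbabilityMeasure (glmLaw ν m z)) :
    Differentiable ℝ m := by
  intro z
  rw [eq_cgf_of_glmLaw h]
  exact (analyticAt_cgf (integrableExpSet_of_glmLaw h z)).differentiableAt

/-- The mean function of a generalized linear model is nondecreasing, because its derivative is a
variance. -/
lemma monotone_deriv_of_glmLaw (h : ∀ z, IsProbabilityMeasure (glmLaw ν m z)) :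
    Monotone (deriv m) := by
  rw [eq_cgf_of_glmLaw h]
  refine monotone_of_deriv_nonneg (fun z =>
    (analyticAt_cgf (integrableExpSet_of_glmLaw h z)).deriv.differentiableAt) fun z => ?_
  have h2 := iteratedDeriv_two_cgf_eq_integral (integrableExpSet_of_glmLaw h z)
  rw [iteratedDeriv_succ, iteratedDeriv_one] at h2
  rw [h2]
  exact div_nonneg (integral_nonneg fun y => by positivity) mgf_nonneg

/-- The moment generating function of a member of the family, centred at `c`. -/
lemma lintegral_exp_sub_glmLaw (h : ∀ z, IsProbabilityMeasure (glmLaw ν m z)) (z ξ c : ℝ) :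
    ∫⁻ y, ENNReal.ofReal (Real.exp (ξ * (y - c))) ∂(glmLaw ν m z) =
      ENNReal.ofReal (Real.exp (m (z + ξ) - m z - ξ * c)) := by
  rw [glmLaw, lintegral_withDensity_eq_lintegral_mul _ (by fun_prop) (by fun_prop)]
  have h2 : ∀ y : ℝ, (fun y => ENNReal.ofReal (Real.exp (y * z - m z))) y *
      ENNReal.ofReal (Real.exp (ξ * (y - c))) =
      ENNReal.ofReal (Real.exp (- m z - ξ * c)) *
        ENNReal.ofReal (Real.exp (y * (z + ξ))) := fun y => by
    rw [← ENNReal.ofReal_mul (Real.exp_pos _).le, ← ENNReal.ofReal_mul (Real.exp_pos _).le,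
      ← Real.exp_add, ← Real.exp_add]
    congr 2; ring
  simp only [Pi.mul_apply]
  simp_rw [h2]
  rw [lintegral_const_mul _ (by fun_prop), lintegral_exp_mul_of_glmLaw h,
    ← ENNReal.ofReal_mul (Real.exp_pos _).le, ← Real.exp_add]
  congr 2; ring

end GLM

/-! ### The curvature of the link function -/

namespace Problem

variable {N K d : ℕ} {B : Problem N K d}

namespace IsAdmissible

lemma differentiable_m (hB : B.IsAdmissible) : Differentiable ℝ B.m :=
  differentiable_of_glmLaw hB.glm

lemma hasDerivAt_m (hB : B.IsAdmissible) (z : ℝ) : HasDerivAt B.m (B.μ z) z :=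
  (hB.differentiable_m z).hasDerivAt

lemma monotone_mu (hB : B.IsAdmissible) : Monotone B.μ := monotone_deriv_of_glmLaw hB.glm

/-- The values `xᵀθ` over which the infimum `κ` is taken fill the interval of radius
`‖θ*‖ + D + 1` around `0`, also those that only a unit vector `x` reaches. -/
lemma kappa_le_deriv (hB : B.IsAdmissible) (hd : 0 < d) {z : ℝ}
    (hz : |z| ≤ ‖B.θstar‖ + B.D + 1) : B.κ ≤ deriv B.μ z := by
  have hD := hB.D_pos
  obtain ⟨e, he, hse⟩ : ∃ e : Feat d, ‖e‖ = 1 ∧ B.θstar = ‖B.θstar‖ • e := by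
    by_cases h0 : B.θstar = 0
    · refine ⟨EuclideanSpace.single ⟨0, hd⟩ 1, by simp, by simp [h0]⟩
    · refine ⟨‖B.θstar‖⁻¹ • B.θstar, ?_, ?_⟩
      · rw [norm_smul, norm_inv, norm_norm, inv_mul_cancel₀ (norm_ne_zero_iff.2 h0)]
      · rw [smul_smul, mul_inv_cancel₀ (norm_ne_zero_iff.2 h0), one_smul]
  have hR : 0 < ‖B.θstar‖ + B.D + 1 := by positivity
  -- `z` is reached by `x = (z / R) e` and `θ = θ* + (D + 1) e = R e`
  set R := ‖B.θstar‖ + B.D + 1 with hRdef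
  have hbdd : BddBelow {k : ℝ | ∃ x θ : Feat d, ‖x‖ ≤ 1 ∧ ‖θ - B.θstar‖ ≤ B.D + 1 ∧
      k = deriv B.μ (inner ℝ x θ)} := by
    by_contra hcon
    have := hB.kappa_pos
    rw [κ, Real.sInf_of_not_bddBelow hcon] at this
    exact lt_irrefl _ this
  refine csInf_le hbdd ⟨(z / R) • e, R • e, ?_, ?_, ?_⟩
  · rw [norm_smul, he, mul_one, Real.norm_eq_abs, abs_div, abs_of_pos hR]
    exact (div_le_one hR).2 hz
  · have : R • e - B.θstar = (B.D + 1) • e := by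
      rw [hse, hRdef]
      rw [← sub_smul]
      congr 1; ring
    rw [this, norm_smul, he, mul_one, Real.norm_eq_abs, abs_of_pos (by positivity)]
  · rw [inner_smul_left, inner_smul_right, real_inner_self_eq_norm_sq, he]
    congr 1
    simp only [conj_trivial]
    field_simp

/-- Strong monotonicity of the mean function on the interval where its derivative is at least `κ`. -/
lemma kappa_mul_sq_le (hB : B.IsAdmissible) (hd : 0 < d) {z w : ℝ}
    (hz : |z| ≤ ‖B.θstar‖ + B.D + 1) (hw : |w| ≤ ‖B.θstar‖ + B.D + 1) :
    B.κ * (w - z) ^ 2 ≤ (B.μ w - B.μ z) * (w - z) := by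
  have key : ∀ a b : ℝ, |a| ≤ ‖B.θstar‖ + B.D + 1 → |b| ≤ ‖B.θstar‖ + B.D + 1 → a ≤ b →
      B.κ * (b - a) ≤ B.μ b - B.μ a := by
    intro a b ha hb hab
    rw [abs_le] at ha hb
    refine Convex.mul_sub_le_image_sub_of_le_deriv (convex_Icc a b)
      hB.mu_differentiable.continuous.continuousOn hB.mu_differentiable.differentiableOn
      (fun x hx => ?_) a (Set.left_mem_Icc.2 hab) b (Set.right_mem_Icc.2 hab) hab
    rw [interior_Icc] at hx
    exact hB.kappa_le_deriv hd (abs_le.2 ⟨ha.1.trans hx.1.le, hx.2.le.trans hb.2⟩)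
  rcases le_total z w with h | h
  · nlinarith [mul_le_mul_of_nonneg_right (key z w hz hw h) (sub_nonneg.2 h)]
  · nlinarith [mul_le_mul_of_nonneg_right (key w z hw hz h) (sub_nonneg.2 h)]

/-- A sub-Gaussian parameter of the noise at a natural parameter `z` bounds the curvature: the
cumulant generating function of the noise grows at least like `κ ξ² / 2` near `0`. -/
lemma kappa_le_sq_of_cgf_le (hB : B.IsAdmissible) (hd : 0 < d) {z : ℝ} (hz : |z| ≤ ‖B.θstar‖)
    (h : ∀ ξ, B.m (z + ξ) - B.m z - ξ * B.μ z ≤ ξ ^ 2 * B.σ ^ 2 / 2) : B.κ ≤ B.σ ^ 2 := by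
  have hD := hB.D_pos
  set F : ℝ → ℝ := fun ξ => B.m (z + ξ) - B.m z - ξ * B.μ z - B.κ * ξ ^ 2 / 2
  have hF : ∀ ξ, HasDerivAt F (B.μ (z + ξ) - B.μ z - B.κ * ξ) ξ := by
    intro ξ
    have h1 : HasDerivAt (fun ξ => B.m (z + ξ)) (B.μ (z + ξ)) ξ :=
      (hB.hasDerivAt_m (z + ξ)).comp_const_add z ξ
    have h2 : HasDerivAt (fun ξ : ℝ => ξ * B.μ z) (1 * B.μ z) ξ := (hasDerivAt_id ξ).mul_const _
    have h3 : HasDerivAt (fun ξ : ℝ => B.κ * ξ ^ 2 / 2) (B.κ * (2 * ξ) / 2) ξ := by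
      simpa using ((hasDerivAt_pow 2 ξ).const_mul B.κ).div_const 2
    exact (((h1.sub_const (B.m z)).sub h2).sub h3).congr_deriv (by ring)
  have hmono : MonotoneOn F (Set.Icc 0 1) := by
    refine monotoneOn_of_deriv_nonneg (convex_Icc 0 1)
      (fun ξ _ => (hF ξ).continuousAt.continuousWithinAt)
      (fun ξ _ => (hF ξ).differentiableAt.differentiableWithinAt) fun ξ hξ => ?_
    rw [interior_Icc] at hξ
    rw [(hF ξ).deriv]
    have h4 := hB.kappa_mul_sq_le hd (z := z) (w := z + ξ) (by linarith)
      ((abs_add_le _ _).trans (by rw [abs_of_pos hξ.1]; linarith [hξ.2]))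
    have h5 : 0 ≤ ξ * (B.μ (z + ξ) - B.μ z - B.κ * ξ) := by nlinarith
    exact nonneg_of_mul_nonneg_right h5 hξ.1
  have h6 := hmono (Set.left_mem_Icc.2 zero_le_one) (Set.right_mem_Icc.2 zero_le_one) zero_le_one
  have h7 := h 1
  simp only [F, add_zero] at h6
  nlinarith

end IsAdmissible

end Problem

end CAB

/-! ### Positive definite matrices -/

namespace CAB

section LinearAlgebra

open Matrix
open scoped MatrixOrder Norms.L2Operator

variable {n : Type*} [Fintype n] [DecidableEq n]

/-- The Cauchy–Schwarz inequality for the dual norms `‖·‖_{W⁻¹}` and `‖·‖_W`. -/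
lemma sq_dotProduct_le_inv_mul {W : Matrix n n ℝ} (hW : W.PosDef) (u v : n → ℝ) :
    (u ⬝ᵥ v) ^ 2 ≤ (u ⬝ᵥ W⁻¹ *ᵥ u) * (v ⬝ᵥ W *ᵥ v) := by
  have hdet : IsUnit W.det := (Matrix.isUnit_iff_isUnit_det W).1 hW.isUnit
  have hsymm : Wᵀ = W := by
    simpa only [conjTranspose_eq_transpose_of_trivial] using hW.isHermitian.eq
  have hWu : W *ᵥ (W⁻¹ *ᵥ u) = u := by
    rw [mulVec_mulVec, mul_nonsing_inv _ hdet, one_mulVec]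
  have h : ∀ t : ℝ, 0 ≤ (u ⬝ᵥ W⁻¹ *ᵥ u) * (t * t) + (2 * (u ⬝ᵥ v)) * t + v ⬝ᵥ W *ᵥ v := by
    intro t
    have h1 := hW.posSemidef.dotProduct_mulVec_nonneg (t • (W⁻¹ *ᵥ u) + v)
    have h2 : (W⁻¹ *ᵥ u) ⬝ᵥ W *ᵥ v = u ⬝ᵥ v := by
      rw [dotProduct_mulVec, ← mulVec_transpose, hsymm, hWu]
    simp only [star_trivial, mulVec_add, mulVec_smul, hWu, add_dotProduct, dotProduct_add,
      smul_dotProduct, dotProduct_smul, smul_eq_mul, h2] at h1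
    rw [dotProduct_comm v u, dotProduct_comm (W⁻¹ *ᵥ u) u] at h1
    linarith
  have h3 := discrim_le_zero h
  rw [discrim] at h3
  nlinarith

/-- Completing the square. -/
lemma dotProduct_sub_quadratic_eq {W : Matrix n n ℝ} (hW : W.PosDef) {c : ℝ} (hc : 0 < c)
    (S ξ : n → ℝ) :
    ξ ⬝ᵥ S - c * (ξ ⬝ᵥ W *ᵥ ξ) = (S ⬝ᵥ W⁻¹ *ᵥ S) / (4 * c) -
      c * ((ξ - (2 * c)⁻¹ • (W⁻¹ *ᵥ S)) ⬝ᵥ W *ᵥ (ξ - (2 * c)⁻¹ • (W⁻¹ *ᵥ S))) := by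
  have hdet : IsUnit W.det := (Matrix.isUnit_iff_isUnit_det W).1 hW.isUnit
  have hsymm : Wᵀ = W := by
    simpa only [conjTranspose_eq_transpose_of_trivial] using hW.isHermitian.eq
  have hWu : W *ᵥ (W⁻¹ *ᵥ S) = S := by
    rw [mulVec_mulVec, mul_nonsing_inv _ hdet, one_mulVec]
  have h2 : (W⁻¹ *ᵥ S) ⬝ᵥ W *ᵥ ξ = S ⬝ᵥ ξ := by
    rw [dotProduct_mulVec, ← mulVec_transpose, hsymm, hWu]
  simp only [mulVec_sub, mulVec_smul, hWu, sub_dotProduct, dotProduct_sub,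
      smul_dotProduct, dotProduct_smul, smul_eq_mul, h2]
  rw [dotProduct_comm S ξ, dotProduct_comm (W⁻¹ *ᵥ S) S]
  field_simp
  ring

lemma one_add_sum_le_prod_one_add {ι : Type*} {s : Finset ι} {e : ι → ℝ} (he : ∀ i ∈ s, 0 ≤ e i) :
    1 + ∑ i ∈ s, e i ≤ ∏ i ∈ s, (1 + e i) := by
  classical
  induction s using Finset.induction_on with
  | empty => simp
  | insert a s ha ih =>
    rw [Finset.sum_insert ha, Finset.prod_insert ha]
    have h0 := he a (Finset.mem_insert_self _ _)
    have h1 := ih fun i hi => he i (Finset.mem_insert_of_mem hi)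
    have h2 : 0 ≤ ∑ i ∈ s, e i :=
      Finset.sum_nonneg fun i hi => he i (Finset.mem_insert_of_mem hi)
    nlinarith

lemma one_add_trace_le_det {E : Matrix n n ℝ} (hE : E.PosSemidef) :
    1 + E.trace ≤ (1 + E).det := by
  have h1 : (1 + E).det = ∏ i, (1 + hE.1.eigenvalues i) := by
    have h2 := hE.1.charpoly_eq
    have h3 : (1 + E).det = (-1) ^ Fintype.card n * E.charpoly.eval (-1) := by
      rw [Matrix.eval_charpoly, ← Matrix.det_neg]
      congr 1
      ext i j
      simp [Matrix.scalar_apply, Matrix.diagonal_apply, Matrix.one_apply]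
      split_ifs <;> ring
    rw [h3, h2, Polynomial.eval_prod, Fintype.card, ← Finset.prod_const, ← Finset.prod_mul_distrib]
    refine Finset.prod_congr rfl fun i _ => ?_
    simp
    ring
  rw [h1, hE.1.trace_eq_sum_eigenvalues]
  exact one_add_sum_le_prod_one_add fun i _ => hE.eigenvalues_nonneg i

/-- Growth of the determinant under a sum of rank-one updates, by the matrix determinant lemma. -/
lemma det_mul_one_add_sum_le {ι : Type*} [Fintype ι] {W : Matrix n n ℝ} (hW : W.PosDef)
    (x : ι → n → ℝ) :
    W.det * (1 + ∑ i, x i ⬝ᵥ W⁻¹ *ᵥ x i) ≤ (W + ∑ i, vecMulVec (x i) (x i)).det := by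
  classical
  have hdet : IsUnit W.det := (Matrix.isUnit_iff_isUnit_det W).1 hW.isUnit
  set X : Matrix n ι ℝ := Matrix.of fun a i => x i a
  have h1 : ∑ i, vecMulVec (x i) (x i) = X * Xᵀ := by
    ext a b
    simp [X, Matrix.sum_apply, vecMulVec_apply, Matrix.mul_apply]
  have h2 : ∑ i, x i ⬝ᵥ W⁻¹ *ᵥ x i = (Xᵀ * W⁻¹ * X).trace := by
    rw [Matrix.trace]
    refine Finset.sum_congr rfl fun i _ => ?_
    rw [diag_apply, Matrix.mul_assoc]
    rfl
  rw [h1, det_add_mul _ _ hdet, h2]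
  refine mul_le_mul_of_nonneg_left (one_add_trace_le_det ?_) hW.det_pos.le
  simpa using hW.inv.posSemidef.conjTranspose_mul_mul_same X

/-- The determinant–trace inequality. -/
lemma det_le_trace_div_pow [Nonempty n] {W : Matrix n n ℝ} (hW : W.PosSemidef) :
    W.det ≤ (W.trace / Fintype.card n) ^ Fintype.card n := by
  have hn : (0 : ℝ) < Fintype.card n := by exact_mod_cast Fintype.card_pos
  have h1 := Real.geom_mean_le_arith_mean (Finset.univ : Finset n) (fun _ => (1 : ℝ))
    hW.1.eigenvalues (fun _ _ => zero_le_one) (by simpa using hn)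
    (fun i _ => hW.eigenvalues_nonneg i)
  simp only [Real.rpow_one, Finset.sum_const, Finset.card_univ, nsmul_eq_mul, mul_one,
    one_mul] at h1
  have h2 : W.det = ∏ i, hW.1.eigenvalues i := by simpa using hW.1.det_eq_prod_eigenvalues
  have h3 : W.trace = ∑ i, hW.1.eigenvalues i := by simpa using hW.1.trace_eq_sum_eigenvalues
  rw [h2, h3]
  have h0 : 0 ≤ ∏ i, hW.1.eigenvalues i := Finset.prod_nonneg fun i _ => hW.eigenvalues_nonneg i
  calc ∏ i, hW.1.eigenvalues i
      = ((∏ i, hW.1.eigenvalues i) ^ (Fintype.card n : ℝ)⁻¹) ^ Fintype.card n := by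
        rw [← Real.rpow_natCast, ← Real.rpow_mul h0, inv_mul_cancel₀ hn.ne', Real.rpow_one]
    _ ≤ _ := pow_le_pow_left₀ (Real.rpow_nonneg h0 _) h1 _

/-- Gaussian integrals are compared with the standard one by the change of variables that a square
root of the matrix gives, so that only the ratio of two normalizing constants appears. -/
lemma sqrt_det_mul_lintegral_exp_neg_quadratic {W : Matrix n n ℝ} (hW : W.PosDef) (c : ℝ) :
    ENNReal.ofReal (Real.sqrt W.det) *
        ∫⁻ ξ : n → ℝ, ENNReal.ofReal (Real.exp (-c * (ξ ⬝ᵥ W *ᵥ ξ))) =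
      ∫⁻ ξ : n → ℝ, ENNReal.ofReal (Real.exp (-c * (ξ ⬝ᵥ ξ))) := by
  obtain ⟨B, hB⟩ : ∃ B : Matrix n n ℝ, W = Bᵀ * B := by
    obtain ⟨B, hB⟩ := CStarAlgebra.nonneg_iff_eq_star_mul_self.1 hW.posSemidef.nonneg
    exact ⟨B, by simpa [Matrix.star_eq_conjTranspose] using hB⟩
  have hdet : W.det = B.det ^ 2 := by rw [hB, det_mul, det_transpose]; ring
  have hB0 : B.det ≠ 0 := fun h => hW.det_pos.ne' (by rw [hdet, h]; simp)
  have hmap := Real.map_matrix_volume_pi_eq_smul_volume_pi hB0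
  have h1 : ∫⁻ ξ, ENNReal.ofReal (Real.exp (-c * (ξ ⬝ᵥ ξ)))
      ∂(Measure.map (Matrix.toLin' B) volume) =
      ∫⁻ ξ : n → ℝ, ENNReal.ofReal (Real.exp (-c * (ξ ⬝ᵥ W *ᵥ ξ))) := by
    rw [lintegral_map (by fun_prop) (LinearMap.continuous_of_finiteDimensional _).measurable]
    refine lintegral_congr fun ξ => ?_
    rw [Matrix.toLin'_apply, hB, ← mulVec_mulVec, ← vecMul_transpose B ξ, ← dotProduct_mulVec,
      vecMul_transpose]
  rw [hmap, lintegral_smul_measure, smul_eq_mul] at h1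
  rw [← h1, ← mul_assoc, hdet, Real.sqrt_sq_eq_abs, ← ENNReal.ofReal_mul (abs_nonneg _),
    ← abs_mul, mul_inv_cancel₀ hB0]
  simp

end LinearAlgebra

lemma lintegral_exp_neg_dotProduct_self_ne_top {ι : Type*} [Fintype ι] {c : ℝ} (hc : 0 < c) :
    ∫⁻ ξ : ι → ℝ, ENNReal.ofReal (Real.exp (-c * (ξ ⬝ᵥ ξ))) ≠ ∞ := by
  have h1 : Integrable (fun ξ : ι → ℝ => ∏ i, Real.exp (-c * (ξ i) ^ 2)) :=
    Integrable.fintype_prod fun i => integrable_exp_neg_mul_sq hc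
  have h2 : (fun ξ : ι → ℝ => ∏ i, Real.exp (-c * (ξ i) ^ 2)) =
      fun ξ => Real.exp (-c * (ξ ⬝ᵥ ξ)) := by
    funext ξ
    rw [← Real.exp_sum, ← Finset.mul_sum, dotProduct]
    simp_rw [sq]
  rw [h2] at h1
  have h3 := h1.2
  rw [hasFiniteIntegral_iff_ofReal (ae_of_all _ fun y => (Real.exp_pos _).le)] at h3
  exact h3.ne

lemma lintegral_exp_neg_dotProduct_self_ne_zero {ι : Type*} [Fintype ι] (c : ℝ) :
    ∫⁻ ξ : ι → ℝ, ENNReal.ofReal (Real.exp (-c * (ξ ⬝ᵥ ξ))) ≠ 0 := by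
  rw [Ne, lintegral_eq_zero_iff (by fun_prop)]
  intro h
  have h1 : ∀ᵐ ξ : ι → ℝ, False := h.mono fun ξ hξ => by
    have := Real.exp_pos (-c * (ξ ⬝ᵥ ξ))
    simp only [Pi.zero_apply, ENNReal.ofReal_eq_zero] at hξ
    linarith
  simp only [Filter.eventually_false_iff_eq_bot, ae_eq_bot] at h1
  exact NeZero.ne (volume : Measure (ι → ℝ)) h1

end CAB

/-! ### The feedback mechanism as a product measure -/

namespace CAB

variable {N K d : ℕ}

section Info

variable {Ω : Type*} {π : ℕ → Ω → Alloc N K} {y : ℕ → Fin N → Ω → ℝ}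

lemma info_eq_comap (t : ℕ) : info π y t = MeasurableSpace.comap
    (fun ω => ((fun (s : Fin t) (i : Fin N) => y s i ω), (fun s : Fin (t + 1) => π s ω)))
    Prod.instMeasurableSpace := rfl

lemma measurable_info_alloc {s t : ℕ} (h : s ≤ t) : Measurable[info π y t] (π s) := by
  have h1 : Measurable fun p : (Fin t → Fin N → ℝ) × (Fin (t + 1) → Alloc N K) =>
      p.2 ⟨s, Nat.lt_succ_of_le h⟩ := by fun_prop
  rw [info_eq_comap]
  exact h1.comp (comap_measurable _)

lemma measurable_info_feedback {s t : ℕ} (h : s < t) (i : Fin N) :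
    Measurable[info π y t] (y s i) := by
  have h1 : Measurable fun p : (Fin t → Fin N → ℝ) × (Fin (t + 1) → Alloc N K) =>
      p.1 ⟨s, h⟩ i := by fun_prop
  rw [info_eq_comap]
  exact h1.comp (comap_measurable _)

end Info

namespace IsFeedback

variable {B : Problem N K d} {Ω : Type*} [mΩ : MeasurableSpace Ω] {P : Measure Ω}
  {π : ℕ → Ω → Alloc N K} {y : ℕ → Fin N → Ω → ℝ}

lemma info_le (h : IsFeedback B P π y) (t : ℕ) : info π y t ≤ mΩ := by
  rw [info_eq_comap]
  exact ((measurable_pi_lambda _ fun s : Fin t => measurable_pi_lambda _ fun i =>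
    h.measurable_feedback s i).prodMk (measurable_pi_lambda _ fun s : Fin (t + 1) =>
      h.measurable_alloc s)).comap_le

/-- On an event that is known before the feedback of round `t` and that fixes the allocation of
round `t`, the feedback vector has the product law of the generalized linear model. -/
lemma map_restrict_eq [IsProbabilityMeasure P] (h : IsFeedback B P π y) (hB : B.IsAdmissible)
    {t : ℕ} (ht : t < B.T) (a : Alloc N K) {A : Set Ω} (hA : MeasurableSet[info π y t] A)
    (hAa : ∀ ω ∈ A, π t ω = a) :
    (P.restrict A).map (fun ω i => y t i ω) =
      P A • Measure.pi fun i => glmLaw B.ν B.m (inner ℝ (B.φ t i (a i)) B.θstar) := by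
  have := hB.glm
  have hle := h.info_le t
  have hym : Measurable fun ω i => y t i ω :=
    measurable_pi_lambda _ fun i => h.measurable_feedback t i
  by_cases h0 : P A = 0
  · rw [Measure.restrict_eq_zero.2 h0, h0]; simp
  have key : ∀ S : Fin N → Set ℝ, (∀ i, MeasurableSet (S i)) →
      (P.restrict A).map (fun ω i => y t i ω) (Set.univ.pi S) =
        P A * ∏ i, glmLaw B.ν B.m (inner ℝ (B.φ t i (a i)) B.θstar) (S i) := by
    intro S hS
    have hE : MeasurableSet {ω | ∀ i, y t i ω ∈ S i} := by
      rw [Set.ofPred_forall]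
      exact MeasurableSet.iInter fun i => h.measurable_feedback t i (hS i)
    have h1 := setIntegral_condExp hle ((integrable_const (1 : ℝ)).indicator (μ := P) hE) hA
    rw [setIntegral_congr_ae (g := fun _ => ∏ i, (glmLaw B.ν B.m
        (inner ℝ (B.φ t i (a i)) B.θstar)).real (S i)) (hle _ hA)
        ((h.law t ht S hS).mono fun ω hω hωA => by
          rw [hω]
          simp only [Problem.x, hAa ω hωA]),
      setIntegral_const, integral_indicator hE, Measure.restrict_restrict hE, setIntegral_const,
      smul_eq_mul, smul_eq_mul, mul_one] at h1
    rw [Measure.map_apply hym (MeasurableSet.univ_pi hS)]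
    have h2 : (fun ω i => y t i ω) ⁻¹' Set.univ.pi S = {ω | ∀ i, y t i ω ∈ S i} := by
      ext ω; simp
    rw [h2, Measure.restrict_apply hE, ← ENNReal.ofReal_toReal (measure_ne_top P _),
      ← Measure.real, ← h1, ENNReal.ofReal_mul measureReal_nonneg,
      ENNReal.ofReal_prod_of_nonneg fun i _ => measureReal_nonneg]
    simp [Measure.real]
  have h3 : Measure.pi (fun i => glmLaw B.ν B.m (inner ℝ (B.φ t i (a i)) B.θstar)) =
      (P A)⁻¹ • (P.restrict A).map (fun ω i => y t i ω) := by
    refine Measure.pi_eq fun S hS => ?_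
    rw [Measure.smul_apply, key S hS, smul_eq_mul, ← mul_assoc,
      ENNReal.inv_mul_cancel h0 (measure_ne_top P A), one_mul]
  rw [h3, smul_smul, ENNReal.mul_inv_cancel h0 (measure_ne_top P A), one_smul]

/-- On the event that the allocation of round `t` is `a`, the feedback vector is independent of the
information that is available before it. -/
lemma setLIntegral_mul_eq [IsProbabilityMeasure P] (h : IsFeedback B P π y)
    (hB : B.IsAdmissible) {t : ℕ} (ht : t < B.T) (a : Alloc N K) {W : Ω → ℝ≥0∞}
    (hW : Measurable[info π y t] W) {G : (Fin N → ℝ) → ℝ≥0∞} (hG : Measurable G) :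
    ∫⁻ ω in π t ⁻¹' {a}, W ω * G (fun i => y t i ω) ∂P =
      (∫⁻ ω in π t ⁻¹' {a}, W ω ∂P) * ∫⁻ v, G v ∂(Measure.pi fun i =>
        glmLaw B.ν B.m (inner ℝ (B.φ t i (a i)) B.θstar)) := by
  have hle := h.info_le t
  have hym : Measurable fun ω i => y t i ω :=
    measurable_pi_lambda _ fun i => h.measurable_feedback t i
  have hGm : Measurable fun ω => G (fun i => y t i ω) := hG.comp hym
  have hQ : MeasurableSet[info π y t] (π t ⁻¹' {a}) :=
    measurable_info_alloc le_rfl (measurableSet_singleton a)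
  set c := ∫⁻ v, G v ∂(Measure.pi fun i =>
        glmLaw B.ν B.m (inner ℝ (B.φ t i (a i)) B.θstar)) with hc
  have hm : ((P.restrict (π t ⁻¹' {a})).withDensity fun ω => G (fun i => y t i ω)).trim hle =
      (c • P.restrict (π t ⁻¹' {a})).trim hle := by
    refine @Measure.ext _ (info π y t) _ _ fun A hA => ?_
    rw [trim_measurableSet_eq hle hA, trim_measurableSet_eq hle hA,
      withDensity_apply _ (hle _ hA), Measure.restrict_restrict (hle _ hA), Measure.smul_apply,
      Measure.restrict_apply (hle _ hA), ← lintegral_map (μ := P.restrict _) hG hym,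
      h.map_restrict_eq hB ht a (hA.inter hQ) (fun ω hω => hω.2), lintegral_smul_measure,
      smul_eq_mul, smul_eq_mul, mul_comm]
  have h1 := congrArg (fun ρ => @lintegral Ω (info π y t) ρ W) hm
  simp only [lintegral_trim hle hW] at h1
  rw [lintegral_withDensity_eq_lintegral_mul _ hGm (hW.mono hle le_rfl),
    lintegral_smul_measure, smul_eq_mul] at h1
  rw [mul_comm, ← h1]
  exact lintegral_congr fun ω => mul_comm _ _

/-- If an allocation occurs in round `t` with positive probability, then each member of the
exponential family that it selects is sub-Gaussian. -/
lemma cgf_le [IsProbabilityMeasure P] (h : IsFeedback B P π y) (hB : B.IsAdmissible)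
    {t : ℕ} (ht : t < B.T) {a : Alloc N K} (ha : P (π t ⁻¹' {a}) ≠ 0) (i : Fin N) (ξ : ℝ) :
    B.m (inner ℝ (B.φ t i (a i)) B.θstar + ξ) - B.m (inner ℝ (B.φ t i (a i)) B.θstar) -
      ξ * B.μ (inner ℝ (B.φ t i (a i)) B.θstar) ≤ ξ ^ 2 * B.σ ^ 2 / 2 := by
  have := hB.glm
  have hle := h.info_le t
  have hQ : MeasurableSet[info π y t] (π t ⁻¹' {a}) :=
    measurable_info_alloc le_rfl (measurableSet_singleton a)
  set z := inner ℝ (B.φ t i (a i)) B.θstar with hz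
  obtain ⟨hint, hsub⟩ := h.subGaussian t ht i ξ
  have h1 := setIntegral_condExp hle hint hQ
  have h2 : ∫ ω in π t ⁻¹' {a}, Real.exp (ξ * (y t i ω -
      B.μ (inner ℝ (B.x (fun s => π s ω) t i) B.θstar))) ∂P ≤
      P.real (π t ⁻¹' {a}) * Real.exp (ξ ^ 2 * B.σ ^ 2 / 2) := by
    rw [← h1]
    refine (setIntegral_mono_ae integrable_condExp.integrableOn
      (integrable_const _).integrableOn hsub).trans ?_
    rw [setIntegral_const, smul_eq_mul]
  have h3 : ∫ ω in π t ⁻¹' {a}, Real.exp (ξ * (y t i ω -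
      B.μ (inner ℝ (B.x (fun s => π s ω) t i) B.θstar))) ∂P =
      ∫ ω in π t ⁻¹' {a}, Real.exp (ξ * (y t i ω - B.μ z)) ∂P := by
    refine setIntegral_congr_fun (hle _ hQ) fun ω hω => ?_
    have : π t ω = a := hω
    simp only [Problem.x, this, hz]
  have h4 := h.setLIntegral_mul_eq hB ht a (W := fun _ => 1) measurable_const
    (G := fun v => ENNReal.ofReal (Real.exp (ξ * (v i - B.μ z)))) (by fun_prop)
  have h5 := (measurePreserving_eval (fun i =>
      glmLaw B.ν B.m (inner ℝ (B.φ t i (a i)) B.θstar)) i).lintegral_comp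
      (f := fun v => ENNReal.ofReal (Real.exp (ξ * (v - B.μ z)))) (by fun_prop)
  simp only [one_mul, lintegral_one, Measure.restrict_apply_univ, Function.eval] at h4 h5
  rw [h5, ← hz, lintegral_exp_sub_glmLaw hB.glm] at h4
  rw [h3, integral_eq_lintegral_of_nonneg_ae (ae_of_all _ fun ω => (Real.exp_pos _).le)
    (by have := h.measurable_feedback t i; fun_prop), h4, ENNReal.toReal_mul,
    ENNReal.toReal_ofReal (Real.exp_pos _).le, ← Measure.real] at h2
  have h6 : 0 < P.real (π t ⁻¹' {a}) := ENNReal.toReal_pos ha (measure_ne_top _ _)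
  exact Real.exp_le_exp.1 (le_of_mul_le_mul_left h2 h6)

end IsFeedback

/-! ### A maximal inequality -/

/-- Ville's inequality over a finite horizon, for a nonnegative supermartingale that is given through
its integrals over the events of the past. -/
lemma measure_exists_le_mul_le {Ω : Type*} [mΩ : MeasurableSpace Ω] {P : Measure Ω}
    {F : ℕ → MeasurableSpace Ω} (hF : ∀ n, F n ≤ mΩ) {Z : ℕ → Ω → ℝ≥0∞}
    (hZ : ∀ n, ∀ s ≤ n, Measurable[F n] (Z s)) (T : ℕ)
    (hsuper : ∀ n < T, ∀ A, MeasurableSet[F n] A → ∫⁻ ω in A, Z (n + 1) ω ∂P ≤ ∫⁻ ω in A, Z n ω ∂P)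
    (c : ℝ≥0∞) :
    c * P {ω | ∃ n ≤ T, c ≤ Z n ω} ≤ ∫⁻ ω, Z 0 ω ∂P := by
  -- `c` times the probability of a crossing before `n`, plus the mass left on the rest, decreases
  have key : ∀ n ≤ T, c * P {ω | ∃ s < n, c ≤ Z s ω} +
      ∫⁻ ω in {ω | ∃ s < n, c ≤ Z s ω}ᶜ, Z n ω ∂P ≤ ∫⁻ ω, Z 0 ω ∂P ∧
      c * P {ω | ∃ s < n + 1, c ≤ Z s ω} +
      ∫⁻ ω in {ω | ∃ s < n + 1, c ≤ Z s ω}ᶜ, Z n ω ∂P ≤ ∫⁻ ω, Z 0 ω ∂P := by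
    have hH : ∀ n, ∀ k, k ≤ n + 1 → MeasurableSet[F n] {ω | ∃ s < k, c ≤ Z s ω} := by
      intro n k hk
      have : {ω | ∃ s < k, c ≤ Z s ω} = ⋃ s ∈ Finset.range k, {ω | c ≤ Z s ω} := by
        ext ω; simp
      rw [this]
      refine MeasurableSet.biUnion (Finset.countable_toSet _) fun s hs => ?_
      have hs' : s ≤ n := by have := Finset.mem_range.1 hs; omega
      exact hZ n s hs' measurableSet_Ici
    have step : ∀ n, c * P {ω | ∃ s < n + 1, c ≤ Z s ω} +
        ∫⁻ ω in {ω | ∃ s < n + 1, c ≤ Z s ω}ᶜ, Z n ω ∂P ≤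
        c * P {ω | ∃ s < n, c ≤ Z s ω} + ∫⁻ ω in {ω | ∃ s < n, c ≤ Z s ω}ᶜ, Z n ω ∂P := by
      intro n
      set H := {ω | ∃ s < n, c ≤ Z s ω}
      set J := {ω | c ≤ Z n ω}
      have hJ : MeasurableSet J := hF n _ (hZ n n le_rfl measurableSet_Ici)
      have hHm : MeasurableSet H := hF n _ (hH n n (Nat.le_succ n))
      have h1 : {ω | ∃ s < n + 1, c ≤ Z s ω} = H ∪ (Hᶜ ∩ J) := by
        ext ω
        simp only [Nat.lt_succ_iff_lt_or_eq, Set.mem_ofPred_eq, Set.mem_union, Set.mem_inter_iff,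
          Set.mem_compl_iff, H, J]
        constructor
        · rintro ⟨s, hs | rfl, h⟩
          · exact Or.inl ⟨s, hs, h⟩
          · by_cases h2 : ∃ r < s, c ≤ Z r ω
            · exact Or.inl h2
            · exact Or.inr ⟨h2, h⟩
        · rintro (⟨s, hs, h⟩ | ⟨-, h⟩)
          · exact ⟨s, Or.inl hs, h⟩
          · exact ⟨n, Or.inr rfl, h⟩
      have h2 : (H ∪ (Hᶜ ∩ J))ᶜ = Hᶜ \ J := by
        ext ω; simp only [Set.mem_compl_iff, Set.mem_union, Set.mem_inter_iff, Set.mem_sdiff]; tauto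
      rw [h1, h2, ← lintegral_inter_add_sdiff (Z n) Hᶜ hJ, ← add_assoc]
      gcongr
      calc c * P (H ∪ (Hᶜ ∩ J)) ≤ c * (P H + P (Hᶜ ∩ J)) := by gcongr; exact measure_union_le _ _
        _ = c * P H + c * P (Hᶜ ∩ J) := mul_add _ _ _
        _ ≤ _ := by
          gcongr
          rw [← setLIntegral_const]
          exact setLIntegral_mono' (hHm.compl.inter hJ) fun ω hω => hω.2
    intro n
    induction n with
    | zero =>
      intro _
      have h0 : c * P {ω | ∃ s < 0, c ≤ Z s ω} +
        ∫⁻ ω in {ω | ∃ s < 0, c ≤ Z s ω}ᶜ, Z 0 ω ∂P ≤ ∫⁻ ω, Z 0 ω ∂P := by simp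
      exact ⟨h0, (step 0).trans h0⟩
    | succ n ih =>
      intro hn
      have h0 : c * P {ω | ∃ s < n + 1, c ≤ Z s ω} +
          ∫⁻ ω in {ω | ∃ s < n + 1, c ≤ Z s ω}ᶜ, Z (n + 1) ω ∂P ≤ ∫⁻ ω, Z 0 ω ∂P := by
        refine le_trans ?_ (ih (by omega)).2
        gcongr 1
        exact hsuper n (by omega) _ (hH n (n + 1) le_rfl).compl
      exact ⟨h0, (step (n + 1)).trans h0⟩
  refine le_trans ?_ (key T le_rfl).2
  simp_rw [Nat.lt_succ_iff]
  exact le_self_add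

end CAB

/-! ### The regularized design matrix -/

namespace CAB

open Matrix

variable {N K d : ℕ}

lemma inner_eq_dotProduct (u v : Feat d) : inner ℝ u v = u.ofLp ⬝ᵥ v.ofLp := by
  rw [EuclideanSpace.inner_eq_star_dotProduct, star_trivial, dotProduct_comm]

lemma dotProduct_self_ofLp (v : Feat d) : v.ofLp ⬝ᵥ v.ofLp = ‖v‖ ^ 2 := by
  rw [← inner_eq_dotProduct, real_inner_self_eq_norm_sq]

namespace Problem

variable (B : Problem N K d) (lam : ℝ) (π : ℕ → Alloc N K)

lemma V_zero : B.V lam π 0 = lam • (1 : Matrix (Fin d) (Fin d) ℝ) := by simp [V]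

lemma V_succ (t : ℕ) : B.V lam π (t + 1) =
    B.V lam π t + ∑ i, vecMulVec (B.x π t i).ofLp (B.x π t i).ofLp := by
  rw [V, V, Finset.sum_range_succ, add_assoc]

lemma dotProduct_V_mulVec (t : ℕ) (v : Fin d → ℝ) :
    v ⬝ᵥ B.V lam π t *ᵥ v = lam * (v ⬝ᵥ v) +
      ∑ s ∈ Finset.range t, ∑ i, (v ⬝ᵥ (B.x π s i).ofLp) ^ 2 := by
  simp only [V, add_mulVec, smul_mulVec, one_mulVec, dotProduct_add, dotProduct_smul, smul_eq_mul,
    Matrix.sum_mulVec, dotProduct_sum, vecMulVec_mulVec]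
  congr 1
  refine Finset.sum_congr rfl fun s _ => Finset.sum_congr rfl fun i _ => ?_
  rw [dotProduct_comm _ v, sq]
  rfl

variable {lam} in
lemma posDef_V (hlam : 0 < lam) (t : ℕ) : (B.V lam π t).PosDef := by
  refine (PosDef.one.smul hlam).add_posSemidef ?_
  refine posSemidef_sum _ fun s _ => posSemidef_sum _ fun i _ => ?_
  simpa using posSemidef_vecMulVec_self_star (B.x π s i).ofLp

lemma trace_V (t : ℕ) : (B.V lam π t).trace =
    lam * d + ∑ s ∈ Finset.range t, ∑ i, ‖B.x π s i‖ ^ 2 := by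
  simp only [V, trace_add, trace_smul, trace_one, Fintype.card_fin, smul_eq_mul, trace_sum,
    trace_vecMulVec, dotProduct_self_ofLp]

variable {B lam} in
lemma IsAdmissible.norm_x_le (hB : B.IsAdmissible) {s : ℕ} (hs : s < B.T) (i : Fin N) :
    ‖B.x π s i‖ ≤ 1 := hB.context_norm_le s hs i _

variable {B lam} in
lemma IsAdmissible.det_V_le (hB : B.IsAdmissible) (hd : 0 < d) (hlam : 0 < lam) {t : ℕ}
    (ht : t ≤ B.T) :
    (B.V lam π t).det ≤ lam ^ d * (1 + N * B.T / (d * lam)) ^ d := by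
  have : Nonempty (Fin d) := ⟨⟨0, hd⟩⟩
  have hd' : (0 : ℝ) < d := by exact_mod_cast hd
  refine (det_le_trace_div_pow (B.posDef_V π hlam t).posSemidef).trans ?_
  rw [Fintype.card_fin, ← mul_pow]
  have h1 : (B.V lam π t).trace ≤ lam * d + N * B.T := by
    rw [B.trace_V]
    have h2 : ∑ s ∈ Finset.range t, ∑ i, ‖B.x π s i‖ ^ 2 ≤
        ∑ s ∈ Finset.range t, ∑ _i : Fin N, (1 : ℝ) := by
      refine Finset.sum_le_sum fun s hs => Finset.sum_le_sum fun i _ => ?_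
      have h3 := hB.norm_x_le π ((Finset.mem_range.1 hs).trans_le ht) i
      exact pow_le_one₀ (norm_nonneg _) h3
    have h4 : (t : ℝ) ≤ B.T := by exact_mod_cast ht
    simp only [Finset.sum_const, Finset.card_univ, Fintype.card_fin, Finset.card_range,
      nsmul_eq_mul, mul_one] at h2
    have h5 : (t : ℝ) * N ≤ N * B.T := by
      rw [mul_comm]; exact mul_le_mul_of_nonneg_left h4 (Nat.cast_nonneg _)
    linarith
  refine pow_le_pow_left₀ (div_nonneg (B.posDef_V π hlam t).posSemidef.trace_nonneg hd'.le) ?_ _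
  rw [div_le_iff₀ hd']
  refine h1.trans (le_of_eq ?_)
  field_simp

/-! ### The self-normalized bound for the noise -/

/-- The sum `∑_{s<t} ∑_i (y_s(i) - μ(x_s(i)ᵀ θ*)) x_s(i)` of the noise weighted by the features. -/
noncomputable def noiseSum (y : ℕ → Fin N → ℝ) (t : ℕ) : Fin d → ℝ :=
  ∑ s ∈ Finset.range t, ∑ i, (y s i - B.μ (inner ℝ (B.x π s i) B.θstar)) • (B.x π s i).ofLp

/-- The logarithm of the exponential supermartingale in direction `ξ`, times an unnormalized Gaussian
density: `ξᵀ S_t - (σ² / 2) ξᵀ V_t ξ` with `S_t` the noise sum. -/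
noncomputable def logWeight (y : ℕ → Fin N → ℝ) (t : ℕ) (ξ : Fin d → ℝ) : ℝ :=
  ξ ⬝ᵥ B.noiseSum π y t - B.σ ^ 2 / 2 * (ξ ⬝ᵥ B.V lam π t *ᵥ ξ)

lemma logWeight_zero (y : ℕ → Fin N → ℝ) (ξ : Fin d → ℝ) :
    B.logWeight lam π y 0 ξ = -(B.σ ^ 2 / 2 * (lam * (ξ ⬝ᵥ ξ))) := by
  simp [logWeight, noiseSum, V_zero, smul_mulVec]

lemma logWeight_succ (y : ℕ → Fin N → ℝ) (t : ℕ) (ξ : Fin d → ℝ) :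
    B.logWeight lam π y (t + 1) ξ = B.logWeight lam π y t ξ +
      ∑ i, ((ξ ⬝ᵥ (B.x π t i).ofLp) * (y t i - B.μ (inner ℝ (B.x π t i) B.θstar)) -
        (ξ ⬝ᵥ (B.x π t i).ofLp) ^ 2 * B.σ ^ 2 / 2) := by
  simp only [logWeight, dotProduct_V_mulVec, noiseSum, Finset.sum_range_succ, dotProduct_add,
    Finset.sum_sub_distrib, dotProduct_sum, dotProduct_smul, smul_eq_mul]
  simp only [mul_div_assoc, ← Finset.sum_mul]
  simp only [mul_comm (ξ ⬝ᵥ (B.x π _ _).ofLp) (_ - _)]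
  ring

lemma measurable_logWeight {Ω : Type*} [MeasurableSpace Ω] {π : ℕ → Ω → Alloc N K}
    {y : ℕ → Fin N → Ω → ℝ} (t : ℕ) (hπ : ∀ s < t, Measurable (π s))
    (hy : ∀ s < t, ∀ i, Measurable (y s i)) :
    Measurable fun p : Ω × (Fin d → ℝ) =>
      B.logWeight lam (fun s => π s p.1) (fun s i => y s i p.1) t p.2 := by
  induction t with
  | zero =>
    simp only [logWeight_zero, dotProduct]
    fun_prop
  | succ t ih =>
    simp only [logWeight_succ]
    refine (ih (fun s hs => hπ s (by omega)) fun s hs => hy s (by omega)).add ?_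
    refine Finset.measurable_sum _ fun i _ => ?_
    have h1 : Measurable fun p : Ω × (Fin d → ℝ) => π t p.1 :=
      (hπ t (Nat.lt_succ_self t)).comp measurable_fst
    have h2 : Measurable fun p : Ω × (Fin d → ℝ) => y t i p.1 :=
      (hy t (Nat.lt_succ_self t) i).comp measurable_fst
    have h3 : Measurable fun p : Ω × (Fin d → ℝ) =>
        p.2 ⬝ᵥ (B.x (fun s => π s p.1) t i).ofLp := by
      have h4 : Measurable fun p : Ω × (Fin d → ℝ) => (B.φ t i (π t p.1 i)).ofLp :=
        (Measurable.of_discrete (f := fun a : Alloc N K => (B.φ t i (a i)).ofLp)).comp h1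
      simp only [dotProduct, x]
      refine Finset.measurable_sum _ fun j _ => ?_
      exact ((measurable_pi_apply j).comp measurable_snd).mul ((measurable_pi_apply j).comp h4)
    have h5 : Measurable fun p : Ω × (Fin d → ℝ) =>
        B.μ (inner ℝ (B.x (fun s => π s p.1) t i) B.θstar) :=
      (Measurable.of_discrete (f := fun a : Alloc N K =>
        B.μ (inner ℝ (B.φ t i (a i)) B.θstar))).comp h1
    exact (h3.mul (h2.sub h5)).sub (((h3.pow_const 2).mul_const _).div_const _)

variable {B lam π} in
/-- The Gaussian mixture of the exponential weights in closed form. -/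
lemma sqrt_det_mul_lintegral_exp_logWeight (hlam : 0 < lam) (hσ : 0 < B.σ)
    (y : ℕ → Fin N → ℝ) (t : ℕ) :
    ENNReal.ofReal (Real.sqrt (B.V lam π t).det) *
      ∫⁻ ξ, ENNReal.ofReal (Real.exp (B.logWeight lam π y t ξ)) =
    ENNReal.ofReal (Real.exp ((B.noiseSum π y t ⬝ᵥ (B.V lam π t)⁻¹ *ᵥ B.noiseSum π y t) /
        (2 * B.σ ^ 2))) *
      ∫⁻ ξ : Fin d → ℝ, ENNReal.ofReal (Real.exp (-(B.σ ^ 2 / 2) * (ξ ⬝ᵥ ξ))) := by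
  have hW := B.posDef_V π hlam t
  set W := B.V lam π t with hWdef
  set S := B.noiseSum π y t with hS
  have hc : 0 < B.σ ^ 2 / 2 := by positivity
  have h1 : ∀ ξ : Fin d → ℝ, ENNReal.ofReal (Real.exp (B.logWeight lam π y t ξ)) =
      ENNReal.ofReal (Real.exp ((S ⬝ᵥ W⁻¹ *ᵥ S) / (2 * B.σ ^ 2))) *
        (fun ζ => ENNReal.ofReal (Real.exp (-(B.σ ^ 2 / 2) * (ζ ⬝ᵥ W *ᵥ ζ))))
          (ξ - (2 * (B.σ ^ 2 / 2))⁻¹ • (W⁻¹ *ᵥ S)) := by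
    intro ξ
    rw [logWeight, ← hWdef, ← hS, dotProduct_sub_quadratic_eq hW hc,
      ← ENNReal.ofReal_mul (Real.exp_pos _).le, ← Real.exp_add]
    congr 2
    rw [show 4 * (B.σ ^ 2 / 2) = 2 * B.σ ^ 2 by ring]
    ring
  have hm : Measurable fun ζ : Fin d → ℝ =>
      ENNReal.ofReal (Real.exp (-(B.σ ^ 2 / 2) * (ζ ⬝ᵥ W *ᵥ ζ))) := by fun_prop
  simp_rw [h1]
  rw [lintegral_const_mul _ (by fun_prop), lintegral_sub_right_eq_self
    (fun ζ : Fin d → ℝ => ENNReal.ofReal (Real.exp (-(B.σ ^ 2 / 2) * (ζ ⬝ᵥ W *ᵥ ζ)))),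
    mul_left_comm, sqrt_det_mul_lintegral_exp_neg_quadratic hW]

end Problem

namespace IsFeedback

variable {B : Problem N K d} {Ω : Type*} [mΩ : MeasurableSpace Ω] {P : Measure Ω}
  {π : ℕ → Ω → Alloc N K} {y : ℕ → Fin N → Ω → ℝ}

/-- Conditionally on its allocation, the feedback of one round multiplies the exponential weight by a
factor of mean at most one. -/
lemma lintegral_pi_exp_le_one [IsProbabilityMeasure P] (h : IsFeedback B P π y)
    (hB : B.IsAdmissible) {t : ℕ} (ht : t < B.T) {a : Alloc N K} (ha : P (π t ⁻¹' {a}) ≠ 0)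
    (q : Fin N → ℝ) :
    ∫⁻ v : Fin N → ℝ, ENNReal.ofReal (Real.exp (∑ i,
        (q i * (v i - B.μ (inner ℝ (B.φ t i (a i)) B.θstar)) - q i ^ 2 * B.σ ^ 2 / 2)))
      ∂(Measure.pi fun i => glmLaw B.ν B.m (inner ℝ (B.φ t i (a i)) B.θstar)) ≤ 1 := by
  have := hB.glm
  set z : Fin N → ℝ := fun i => inner ℝ (B.φ t i (a i)) B.θstar with hz
  set g : Fin N → ℝ → ℝ≥0∞ := fun i w => ENNReal.ofReal
    (Real.exp (q i * (w - B.μ (z i)) - q i ^ 2 * B.σ ^ 2 / 2)) with hg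
  have hgm : ∀ i, Measurable (g i) := fun i => by simp only [hg]; fun_prop
  have h1 : ∀ v : Fin N → ℝ, ENNReal.ofReal (Real.exp (∑ i,
        (q i * (v i - B.μ (z i)) - q i ^ 2 * B.σ ^ 2 / 2))) = ∏ i, g i (v i) := fun v => by
    rw [Real.exp_sum, ENNReal.ofReal_prod_of_nonneg fun i _ => (Real.exp_pos _).le]
  refine (lintegral_congr h1).trans_le ?_
  change ∫⁻ v : Fin N → ℝ, ∏ i, g i (v i) ∂(Measure.pi fun i => glmLaw B.ν B.m (z i)) ≤ 1
  rw [lintegral_prod_eq_prod_lintegral_of_indepFun Finset.univ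
    (fun i (v : Fin N → ℝ) => g i (v i))
    (iIndepFun_pi fun i => (hgm i).aemeasurable)
    (fun i => (hgm i).comp (measurable_pi_apply i))]
  refine Finset.prod_le_one' fun i _ => ?_
  have h2 := (measurePreserving_eval (fun i => glmLaw B.ν B.m (z i)) i).lintegral_comp (hgm i)
  rw [h2]
  have h3 : ∀ w, g i w = ENNReal.ofReal (Real.exp (-(q i ^ 2 * B.σ ^ 2 / 2))) *
      ENNReal.ofReal (Real.exp (q i * (w - B.μ (z i)))) := fun w => by
    rw [← ENNReal.ofReal_mul (Real.exp_pos _).le, ← Real.exp_add]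
    simp only [hg]
    congr 2; ring
  simp_rw [h3]
  rw [lintegral_const_mul _ (by fun_prop), lintegral_exp_sub_glmLaw hB.glm,
    ← ENNReal.ofReal_mul (Real.exp_pos _).le, ← Real.exp_add]
  refine ENNReal.ofReal_le_one.2 (Real.exp_le_one_iff.2 ?_)
  have h4 := h.cgf_le hB ht ha i (q i)
  simp only [hz]
  linarith

lemma setLIntegral_exp_logWeight_succ_le [IsProbabilityMeasure P] (h : IsFeedback B P π y)
    (hB : B.IsAdmissible) (lam : ℝ) {t : ℕ} (ht : t < B.T) {A : Set Ω}
    (hA : MeasurableSet[info π y t] A) (ξ : Fin d → ℝ) :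
    ∫⁻ ω in A, ENNReal.ofReal (Real.exp
        (B.logWeight lam (fun s => π s ω) (fun s i => y s i ω) (t + 1) ξ)) ∂P ≤
      ∫⁻ ω in A, ENNReal.ofReal (Real.exp
        (B.logWeight lam (fun s => π s ω) (fun s i => y s i ω) t ξ)) ∂P := by
  have hle := h.info_le t
  set W : Ω → ℝ≥0∞ := A.indicator fun ω => ENNReal.ofReal (Real.exp
        (B.logWeight lam (fun s => π s ω) (fun s i => y s i ω) t ξ)) with hWdef
  have hW : Measurable[info π y t] W := by
    have h1 := @Problem.measurable_logWeight N K d B lam Ω (info π y t) π y t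
      (fun s hs => measurable_info_alloc hs.le) (fun s hs i => measurable_info_feedback hs i)
    exact Measurable.indicator (m := info π y t)
      (ENNReal.measurable_ofReal.comp (Real.measurable_exp.comp
        (h1.comp (@measurable_prodMk_right _ _ (info π y t) _ ξ)))) hA
  rw [← lintegral_indicator (hle _ hA), ← lintegral_indicator (hle _ hA), ← hWdef]
  set G : Alloc N K → (Fin N → ℝ) → ℝ≥0∞ := fun a v => ENNReal.ofReal (Real.exp (∑ i,
        ((ξ ⬝ᵥ (B.φ t i (a i)).ofLp) * (v i - B.μ (inner ℝ (B.φ t i (a i)) B.θstar)) -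
          (ξ ⬝ᵥ (B.φ t i (a i)).ofLp) ^ 2 * B.σ ^ 2 / 2))) with hG
  have h1 : (A.indicator fun ω => ENNReal.ofReal (Real.exp
        (B.logWeight lam (fun s => π s ω) (fun s i => y s i ω) (t + 1) ξ))) =
      fun ω => W ω * G (π t ω) (fun i => y t i ω) := by
    funext ω
    by_cases hω : ω ∈ A
    · rw [hWdef, Set.indicator_of_mem hω, Set.indicator_of_mem hω, Problem.logWeight_succ,
        Real.exp_add, ENNReal.ofReal_mul (Real.exp_pos _).le]
      rfl
    · rw [hWdef, Set.indicator_of_notMem hω, Set.indicator_of_notMem hω, zero_mul]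
  have hQ : ∀ a, MeasurableSet (π t ⁻¹' {a}) := fun a =>
    h.measurable_alloc t (measurableSet_singleton a)
  have hdisj : Pairwise (Function.onFun Disjoint fun a => π t ⁻¹' {a}) := fun a b hab =>
    Disjoint.preimage _ (Set.disjoint_singleton.2 hab)
  have hun : (⋃ a, π t ⁻¹' {a}) = Set.univ := by
    ext ω; simp
  rw [h1, ← setLIntegral_univ, ← setLIntegral_univ W, ← hun, lintegral_iUnion hQ hdisj,
    lintegral_iUnion hQ hdisj]
  refine ENNReal.tsum_le_tsum fun a => ?_
  rw [setLIntegral_congr_fun (g := fun ω => W ω * G a (fun i => y t i ω)) (hQ a) (fun ω hω => by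
    have : π t ω = a := hω
    simp only [this])]
  rw [h.setLIntegral_mul_eq hB ht a hW (by simp only [hG]; fun_prop)]
  by_cases ha : P (π t ⁻¹' {a}) = 0
  · rw [Measure.restrict_eq_zero.2 ha]; simp
  · exact mul_le_of_le_one_right' (h.lintegral_pi_exp_le_one hB ht ha _)

/-- The self-normalized bound for vector-valued martingales (method of mixtures): outside of an event
of probability at most `δ`, all the noise sums are controlled in the norms `‖·‖_{V_t⁻¹}`. -/
lemma measure_noiseSum_gt_le [IsProbabilityMeasure P] (h : IsFeedback B P π y)
    (hB : B.IsAdmissible) (hd : 0 < d) {lam δ : ℝ} (hlam : 0 < lam) (hδ : 0 < δ) :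
    P {ω | ¬ ∀ t ≤ B.T, ∀ v : Fin d → ℝ, v ⬝ᵥ B.noiseSum (fun s => π s ω) (fun s i => y s i ω) t ≤
      B.σ * Real.sqrt (d * Real.log (1 + N * B.T / (d * lam)) + 2 * Real.log (1 / δ)) *
        Real.sqrt (v ⬝ᵥ B.V lam (fun s => π s ω) t *ᵥ v)} ≤ ENNReal.ofReal δ := by
  have hσ := hB.sigma_pos
  set Z : ℕ → Ω → ℝ≥0∞ := fun t ω => ∫⁻ ξ, ENNReal.ofReal (Real.exp
    (B.logWeight lam (fun s => π s ω) (fun s i => y s i ω) t ξ)) with hZdef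
  set I : ℝ≥0∞ := ∫⁻ ξ : Fin d → ℝ, ENNReal.ofReal (Real.exp (-(B.σ ^ 2 / 2) * (ξ ⬝ᵥ ξ))) with hI
  have hI0 : I ≠ 0 := lintegral_exp_neg_dotProduct_self_ne_zero _
  have hItop : I ≠ ∞ := lintegral_exp_neg_dotProduct_self_ne_top (by positivity)
  have hjoint : ∀ t s, s ≤ t → Measurable[(info π y t).prod MeasurableSpace.pi]
      fun p : Ω × (Fin d → ℝ) => ENNReal.ofReal (Real.exp
        (B.logWeight lam (fun s => π s p.1) (fun s i => y s i p.1) s p.2)) := by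
    intro t s hst
    exact ENNReal.measurable_ofReal.comp (Real.measurable_exp.comp
      (@Problem.measurable_logWeight N K d B lam Ω (info π y t) π y s
      (fun r hr => measurable_info_alloc (by omega))
      (fun r hr i => measurable_info_feedback (by omega) i)))
  have hZ : ∀ t, ∀ s ≤ t, Measurable[info π y t] (Z s) := by
    intro t s hst
    exact @Measurable.lintegral_prod_right' Ω (Fin d → ℝ) (info π y t) _ volume _ _ (hjoint t s hst)
  have hjoint' : ∀ s, Measurable fun p : Ω × (Fin d → ℝ) => ENNReal.ofReal (Real.exp
        (B.logWeight lam (fun s => π s p.1) (fun s i => y s i p.1) s p.2)) := fun s =>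
    ENNReal.measurable_ofReal.comp (Real.measurable_exp.comp
      (B.measurable_logWeight lam s (fun r _ => h.measurable_alloc r)
        fun r _ i => h.measurable_feedback r i))
  have hsuper : ∀ t < B.T, ∀ A, MeasurableSet[info π y t] A →
      ∫⁻ ω in A, Z (t + 1) ω ∂P ≤ ∫⁻ ω in A, Z t ω ∂P := by
    intro t ht A hA
    have hswap : ∀ s, ∫⁻ ω in A, Z s ω ∂P = ∫⁻ ξ, ∫⁻ ω in A, ENNReal.ofReal (Real.exp
        (B.logWeight lam (fun s => π s ω) (fun s i => y s i ω) s ξ)) ∂P := fun s =>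
      lintegral_lintegral_swap (hjoint' s).aemeasurable
    rw [hswap, hswap]
    exact lintegral_mono fun ξ => h.setLIntegral_exp_logWeight_succ_le hB lam ht hA ξ
  set D₀ : ℝ := Real.sqrt (lam ^ d) with hD0
  have hD0pos : 0 < D₀ := Real.sqrt_pos.2 (by positivity)
  have hZ0 : ∀ ω, Z 0 ω = (ENNReal.ofReal D₀)⁻¹ * I := by
    intro ω
    have h1 := Problem.sqrt_det_mul_lintegral_exp_logWeight (B := B) (π := fun s => π s ω)
      hlam hσ (fun s i => y s i ω) 0
    have h2 : B.noiseSum (fun s => π s ω) (fun s i => y s i ω) 0 = 0 := by simp [Problem.noiseSum]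
    rw [h2, zero_dotProduct, zero_div, Real.exp_zero, ENNReal.ofReal_one, one_mul, Problem.V_zero,
      det_smul, det_one, mul_one, Fintype.card_fin, ← hD0, ← hI] at h1
    rw [← h1, ← mul_assoc, ENNReal.inv_mul_cancel (by simpa using hD0pos) ENNReal.ofReal_ne_top,
      one_mul]
  have hville := measure_exists_le_mul_le (P := P) (F := fun t => info π y t) h.info_le hZ B.T
    hsuper ((ENNReal.ofReal D₀)⁻¹ * I * (ENNReal.ofReal δ)⁻¹)
  simp_rw [hZ0] at hville
  rw [lintegral_const, measure_univ, mul_one] at hville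
  have hc0 : (ENNReal.ofReal D₀)⁻¹ * I ≠ 0 := mul_ne_zero (by simp) hI0
  have hctop : (ENNReal.ofReal D₀)⁻¹ * I ≠ ∞ :=
    ENNReal.mul_ne_top (by simpa using hD0pos) hItop
  have hδ0 : ENNReal.ofReal δ ≠ 0 := by simpa using hδ
  have hP : P {ω | ∃ n ≤ B.T, (ENNReal.ofReal D₀)⁻¹ * I * (ENNReal.ofReal δ)⁻¹ ≤ Z n ω} ≤
      ENNReal.ofReal δ := by
    rw [mul_assoc, mul_comm ((ENNReal.ofReal D₀)⁻¹ * I) (_ * _),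
      ← ENNReal.le_div_iff_mul_le (Or.inl hc0) (Or.inl hctop),
      ENNReal.div_self hc0 hctop, mul_comm, ← div_eq_mul_inv,
      ENNReal.div_le_iff hδ0 ENNReal.ofReal_ne_top, one_mul] at hville
    exact hville
  refine (measure_mono fun ω hω => ?_).trans hP
  by_contra hcon
  refine hω fun t ht v => ?_
  have hlt : Z t ω < (ENNReal.ofReal D₀)⁻¹ * I * (ENNReal.ofReal δ)⁻¹ := by
    by_contra h1
    exact hcon ⟨t, ht, not_lt.1 h1⟩
  set V := B.V lam (fun s => π s ω) t with hV
  set S := B.noiseSum (fun s => π s ω) (fun s i => y s i ω) t with hS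
  have hVpd : V.PosDef := B.posDef_V _ hlam t
  have hclosed := Problem.sqrt_det_mul_lintegral_exp_logWeight (B := B) (π := fun s => π s ω)
      hlam hσ (fun s i => y s i ω) t
  rw [← hV, ← hS, ← hI] at hclosed
  have hdetpos : 0 < Real.sqrt V.det := Real.sqrt_pos.2 hVpd.det_pos
  -- the closed form of the mixture turns the bound on `Z` into a bound on `Sᵀ V⁻¹ S`
  have hexp : Real.exp ((S ⬝ᵥ V⁻¹ *ᵥ S) / (2 * B.σ ^ 2)) ≤ Real.sqrt V.det * (D₀⁻¹ * δ⁻¹) := by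
    have h1 : ENNReal.ofReal (Real.exp ((S ⬝ᵥ V⁻¹ *ᵥ S) / (2 * B.σ ^ 2))) * I ≤
        ENNReal.ofReal (Real.sqrt V.det * (D₀⁻¹ * δ⁻¹)) * I := by
      rw [← hclosed]
      refine (mul_le_mul_right hlt.le _).trans (le_of_eq ?_)
      rw [ENNReal.ofReal_mul hdetpos.le, ENNReal.ofReal_mul (by positivity),
        ENNReal.ofReal_inv_of_pos hD0pos, ENNReal.ofReal_inv_of_pos hδ]
      ring
    have h2 := (ENNReal.mul_le_mul_iff_left hI0 hItop).1 h1
    exact (ENNReal.ofReal_le_ofReal_iff (by positivity)).1 h2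
  have hβ : S ⬝ᵥ V⁻¹ *ᵥ S ≤ B.σ ^ 2 *
      (d * Real.log (1 + N * B.T / (d * lam)) + 2 * Real.log (1 / δ)) := by
    have h1 := (Real.le_log_iff_exp_le (by positivity)).2 hexp
    have hd' : (0 : ℝ) < d := by exact_mod_cast hd
    have hb : (0 : ℝ) < 1 + N * B.T / (d * lam) := by positivity
    have h2 : Real.log (Real.sqrt V.det * (D₀⁻¹ * δ⁻¹)) ≤
        (d * Real.log (1 + N * B.T / (d * lam)) + 2 * Real.log (1 / δ)) / 2 := by
      have h3 : Real.log V.det ≤ d * Real.log lam + d * Real.log (1 + N * B.T / (d * lam)) := by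
        refine (Real.log_le_log hVpd.det_pos
          (hB.det_V_le (fun s => π s ω) hd hlam ht)).trans (le_of_eq ?_)
        rw [Real.log_mul (by positivity) (by positivity), Real.log_pow, Real.log_pow]
      rw [Real.log_mul (by positivity) (by positivity), Real.log_mul (by positivity)
        (by positivity), Real.log_sqrt hVpd.det_pos.le, Real.log_inv, hD0,
        Real.log_sqrt (by positivity), Real.log_pow, one_div, Real.log_inv]
      linarith
    have h4 := h1.trans h2
    rw [div_le_iff₀ (by positivity)] at h4
    linarith
  have hcs := sq_dotProduct_le_inv_mul hVpd S v
  have hq : 0 ≤ v ⬝ᵥ V *ᵥ v := by simpa using hVpd.posSemidef.dotProduct_mulVec_nonneg v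
  have hSn : 0 ≤ S ⬝ᵥ V⁻¹ *ᵥ S := by
    simpa using hVpd.inv.posSemidef.dotProduct_mulVec_nonneg S
  rw [dotProduct_comm v S]
  refine (Real.le_sqrt_of_sq_le (hcs.trans (mul_le_mul_of_nonneg_right hβ hq))).trans (le_of_eq ?_)
  rw [Real.sqrt_mul (hSn.trans hβ), Real.sqrt_mul (by positivity), Real.sqrt_sq hσ.le]

end IsFeedback

end CAB

/-! ### The confidence ellipsoid of the penalized maximum likelihood estimator -/

namespace CAB

open Matrix

variable {N K d : ℕ}

namespace Problem

variable {B : Problem N K d} {π : ℕ → Alloc N K} {y : ℕ → Fin N → ℝ}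

lemma dotProduct_noiseSum (B : Problem N K d) (π : ℕ → Alloc N K) (y : ℕ → Fin N → ℝ) (t : ℕ)
    (v : Feat d) : v.ofLp ⬝ᵥ B.noiseSum π y t = ∑ s ∈ Finset.range t, ∑ i,
      (y s i - B.μ (inner ℝ (B.x π s i) B.θstar)) * inner ℝ (B.x π s i) v := by
  simp only [noiseSum, dotProduct_sum, dotProduct_smul, smul_eq_mul, inner_eq_dotProduct]
  simp only [dotProduct_comm v.ofLp]

/-- The first-order condition at the estimator, propagated along the segment to `θ*` by convexity of
the loss. -/
lemma IsAdmissible.sum_mu_sub_mul_le (hB : B.IsAdmissible) {lam : ℝ} (hlam : 0 ≤ lam) {t : ℕ}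
    {θbar : Feat d} (hmin : ∀ θ, B.loss lam π y t θbar ≤ B.loss lam π y t θ) {γ : ℝ} (hγ : γ ≤ 1) :
    ∑ s ∈ Finset.range t, ∑ i,
      (B.μ (inner ℝ (B.x π s i) B.θstar + γ * inner ℝ (B.x π s i) (θbar - B.θstar)) -
        B.μ (inner ℝ (B.x π s i) B.θstar)) * inner ℝ (B.x π s i) (θbar - B.θstar) +
      lam * γ * ‖θbar - B.θstar‖ ^ 2 ≤
    (θbar - B.θstar).ofLp ⬝ᵥ B.noiseSum π y t - lam * inner ℝ B.θstar (θbar - B.θstar) := by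
  set Δ := θbar - B.θstar with hΔ
  set p : ℝ → ℝ := fun s => B.loss lam π y t (B.θstar + s • Δ) with hp
  set p' : ℝ → ℝ := fun r => (∑ s ∈ Finset.range t, ∑ i,
      (B.μ (inner ℝ (B.x π s i) B.θstar + r * inner ℝ (B.x π s i) Δ) - y s i) *
        inner ℝ (B.x π s i) Δ) + lam * (inner ℝ B.θstar Δ + r * ‖Δ‖ ^ 2) with hp'
  have hder : ∀ r, HasDerivAt p (p' r) r := by
    intro r
    have h1 : p = fun r => (∑ s ∈ Finset.range t, ∑ i,
        (B.m (inner ℝ (B.x π s i) B.θstar + r * inner ℝ (B.x π s i) Δ) -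
          y s i * (inner ℝ (B.x π s i) B.θstar + r * inner ℝ (B.x π s i) Δ))) +
        lam / 2 * (‖B.θstar‖ ^ 2 + 2 * (r * inner ℝ B.θstar Δ) + r ^ 2 * ‖Δ‖ ^ 2) := by
      funext r
      simp only [hp, loss, inner_add_right, inner_smul_right, norm_add_sq_real, norm_smul, mul_pow,
        Real.norm_eq_abs, sq_abs]
    rw [h1]
    refine HasDerivAt.add (HasDerivAt.fun_sum fun s _ => HasDerivAt.fun_sum fun i _ => ?_) ?_
    · have h2 : HasDerivAt (fun r => inner ℝ (B.x π s i) B.θstar + r * inner ℝ (B.x π s i) Δ)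
          (inner ℝ (B.x π s i) Δ) r := by
        simpa using ((hasDerivAt_id r).mul_const (inner ℝ (B.x π s i) Δ)).const_add
          (inner ℝ (B.x π s i) B.θstar)
      exact (((hB.hasDerivAt_m _).comp r h2).sub (h2.const_mul (y s i))).congr_deriv (by ring)
    · have h3 : HasDerivAt (fun r : ℝ => ‖B.θstar‖ ^ 2 + 2 * (r * inner ℝ B.θstar Δ) +
          r ^ 2 * ‖Δ‖ ^ 2) (2 * inner ℝ B.θstar Δ + 2 * r * ‖Δ‖ ^ 2) r := by
        have h4 := (((hasDerivAt_id r).mul_const (inner ℝ B.θstar Δ)).const_mul 2).const_add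
          (‖B.θstar‖ ^ 2)
        have h5 := (hasDerivAt_pow 2 r).mul_const (‖Δ‖ ^ 2)
        exact (h4.add h5).congr_deriv (by simp)
      exact (h3.const_mul (lam / 2)).congr_deriv (by ring)
  have h1 : p' 1 = 0 := by
    have hloc : IsLocalMin p 1 := Filter.Eventually.of_forall fun r => by
      have : B.θstar + (1 : ℝ) • Δ = θbar := by rw [one_smul, hΔ]; abel
      simp only [hp, this]
      exact hmin _
    exact hloc.hasDerivAt_eq_zero (hder 1)
  have h2 : p' γ ≤ p' 1 := by
    simp only [hp']
    refine add_le_add (Finset.sum_le_sum fun s _ => Finset.sum_le_sum fun i _ => ?_) ?_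
    · set q := inner ℝ (B.x π s i) Δ
      set z := inner ℝ (B.x π s i) B.θstar
      rcases le_total 0 q with hq | hq
      · have := hB.monotone_mu (show z + γ * q ≤ z + 1 * q by nlinarith)
        nlinarith
      · have := hB.monotone_mu (show z + 1 * q ≤ z + γ * q by nlinarith)
        nlinarith
    · have : γ * ‖Δ‖ ^ 2 ≤ 1 * ‖Δ‖ ^ 2 := mul_le_mul_of_nonneg_right hγ (sq_nonneg _)
      exact mul_le_mul_of_nonneg_left (by linarith) hlam
  rw [h1] at h2
  simp only [hp'] at h2
  have h3 : ∑ s ∈ Finset.range t, ∑ i,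
      (B.μ (inner ℝ (B.x π s i) B.θstar + γ * inner ℝ (B.x π s i) Δ) - y s i) *
        inner ℝ (B.x π s i) Δ =
      ∑ s ∈ Finset.range t, ∑ i,
      (B.μ (inner ℝ (B.x π s i) B.θstar + γ * inner ℝ (B.x π s i) Δ) -
        B.μ (inner ℝ (B.x π s i) B.θstar)) * inner ℝ (B.x π s i) Δ -
      Δ.ofLp ⬝ᵥ B.noiseSum π y t := by
    rw [dotProduct_noiseSum, ← Finset.sum_sub_distrib]
    refine Finset.sum_congr rfl fun s _ => ?_
    rw [← Finset.sum_sub_distrib]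
    exact Finset.sum_congr rfl fun i _ => by ring
  rw [h3] at h2
  linarith

/-- Strong convexity of the loss at a point `v = γ (θbar - θ*)` of the segment at which no past
feature sees a deviation from `θ*` of more than `D + 1`. -/
lemma IsAdmissible.kappa_mul_quadratic_le (hB : B.IsAdmissible) (hd : 0 < d) {lam : ℝ}
    (hlam : 0 < lam) {t : ℕ} (ht : t ≤ B.T) {θbar : Feat d}
    (hmin : ∀ θ, B.loss (B.κ * lam) π y t θbar ≤ B.loss (B.κ * lam) π y t θ) {γ : ℝ} (hγ0 : 0 ≤ γ)
    (hγ : γ ≤ 1)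
    (hrange : ∀ s < t, ∀ i, |γ * inner ℝ (B.x π s i) (θbar - B.θstar)| ≤ B.D + 1) :
    B.κ * ((∑ s ∈ Finset.range t, ∑ i, (inner ℝ (B.x π s i) (γ • (θbar - B.θstar))) ^ 2) +
        lam * ‖γ • (θbar - B.θstar)‖ ^ 2) ≤
      (γ • (θbar - B.θstar)).ofLp ⬝ᵥ B.noiseSum π y t +
        B.κ * lam * B.D * ‖γ • (θbar - B.θstar)‖ := by
  have hκ := hB.kappa_pos
  have h1 := hB.sum_mu_sub_mul_le (mul_pos hκ hlam).le hmin hγ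
  set Δ := θbar - B.θstar with hΔ
  have h2 := mul_le_mul_of_nonneg_left h1 hγ0
  have h3 : B.κ * (∑ s ∈ Finset.range t, ∑ i, (inner ℝ (B.x π s i) (γ • Δ)) ^ 2) ≤
      γ * ∑ s ∈ Finset.range t, ∑ i,
      (B.μ (inner ℝ (B.x π s i) B.θstar + γ * inner ℝ (B.x π s i) Δ) -
        B.μ (inner ℝ (B.x π s i) B.θstar)) * inner ℝ (B.x π s i) Δ := by
    simp only [Finset.mul_sum]
    refine Finset.sum_le_sum fun s hs => Finset.sum_le_sum fun i _ => ?_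
    have hs' := Finset.mem_range.1 hs
    have hz : |inner ℝ (B.x π s i) B.θstar| ≤ ‖B.θstar‖ := by
      refine (abs_real_inner_le_norm _ _).trans ?_
      exact mul_le_of_le_one_left (norm_nonneg _) (hB.norm_x_le π (hs'.trans_le ht) i)
    have h4 := hB.kappa_mul_sq_le hd
      (z := inner ℝ (B.x π s i) B.θstar)
      (w := inner ℝ (B.x π s i) B.θstar + γ * inner ℝ (B.x π s i) Δ)
      (by linarith [hB.D_pos])
      ((abs_add_le _ _).trans (by linarith [hrange s hs' i]))
    rw [inner_smul_right]
    rw [add_sub_cancel_left] at h4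
    linarith
  have h4 : -(γ * inner ℝ B.θstar Δ) ≤ B.D * ‖γ • Δ‖ := by
    rw [← inner_smul_right]
    refine (neg_le_abs _).trans ((abs_real_inner_le_norm _ _).trans ?_)
    exact mul_le_mul_of_nonneg_right hB.theta_norm_le (norm_nonneg _)
  have h5 : ‖γ • Δ‖ ^ 2 = γ ^ 2 * ‖Δ‖ ^ 2 := by
    rw [norm_smul, mul_pow, Real.norm_eq_abs, sq_abs]
  have h6 : (γ • Δ).ofLp ⬝ᵥ B.noiseSum π y t = γ * (Δ.ofLp ⬝ᵥ B.noiseSum π y t) := by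
    rw [WithLp.ofLp_smul, smul_dotProduct, smul_eq_mul]
  have h7 := mul_le_mul_of_nonneg_left h4 (mul_pos hκ hlam).le
  rw [h6, h5]
  linarith

lemma dotProduct_V_mulVec_ofLp (B : Problem N K d) (lam : ℝ) (π : ℕ → Alloc N K) (t : ℕ)
    (v : Feat d) : v.ofLp ⬝ᵥ B.V lam π t *ᵥ v.ofLp =
      (∑ s ∈ Finset.range t, ∑ i, (inner ℝ (B.x π s i) v) ^ 2) + lam * ‖v‖ ^ 2 := by
  rw [dotProduct_V_mulVec, dotProduct_self_ofLp, add_comm]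
  simp only [inner_eq_dotProduct, dotProduct_comm v.ofLp]

/-- The inequality that rules out a point `v` of the segment with `A = ∑ (xᵀ v)²` and `b = ‖v‖`: its
left-hand side is what the noise can contribute, its right-hand side the curvature. -/
lemma sqrt_mul_sqrt_lt {A b D lam : ℝ} (hD : 0 < D) (hlam : 0 < lam) (hA : (D + 1) ^ 2 ≤ A)
    (hb : D + 1 ≤ b) :
    Real.sqrt lam * Real.sqrt (A + b ^ 2) < A + lam * b ^ 2 - lam * D * b := by
  obtain ⟨E, hE⟩ : ∃ E, E = D + 1 := ⟨_, rfl⟩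
  rw [← hE] at hA hb
  have hE1 : 1 < E := by linarith
  have hb0 : 0 < b := by linarith
  have hA0 : 0 < A := by nlinarith
  have h3 : b ^ 2 / E ≤ b ^ 2 - D * b := by
    rw [div_le_iff₀ (by linarith)]
    have h0 : 0 ≤ b * (D * (b - E)) := by
      have : 0 ≤ b - E := by linarith
      positivity
    have h1 : (b ^ 2 - D * b) * E = b ^ 2 + b * (D * (b - E)) := by rw [hE]; ring
    linarith
  have h2 : A + lam * (b ^ 2 / E) ≤ A + lam * b ^ 2 - lam * D * b := by
    linarith [mul_le_mul_of_nonneg_left h3 hlam.le]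
  refine lt_of_lt_of_le ?_ h2
  have hbE : E ^ 2 ≤ b ^ 2 := pow_le_pow_left₀ (by linarith) hb 2
  have h5 : A ≤ A * (b ^ 2 / E) := by
    refine le_mul_of_one_le_right hA0.le ?_
    rw [le_div_iff₀ (by linarith)]
    nlinarith
  have h6 : b ^ 2 ≤ A * (b ^ 2 / E) := by
    rw [mul_div_assoc', le_div_iff₀ (by linarith), mul_comm]
    exact mul_le_mul_of_nonneg_right (by nlinarith) (sq_nonneg b)
  rw [← Real.sqrt_mul hlam.le]
  refine (Real.sqrt_lt' (by positivity)).2 ?_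
  have h7 : 0 < A ^ 2 := by positivity
  have h8 := mul_le_mul_of_nonneg_left (add_le_add h5 h6) hlam.le
  have h9 := sq_nonneg (lam * (b ^ 2 / E))
  calc lam * (A + b ^ 2) ≤ lam * (A * (b ^ 2 / E) + A * (b ^ 2 / E)) := h8
    _ < A ^ 2 + lam * (A * (b ^ 2 / E) + A * (b ^ 2 / E)) + (lam * (b ^ 2 / E)) ^ 2 := by linarith
    _ = (A + lam * (b ^ 2 / E)) ^ 2 := by ring

/-- If the noise is controlled in the norm of `V_t` with unit regularization, then none of the past
features sees a large deviation of the estimator, so that the curvature bound `κ` is available on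
the whole segment between `θ*` and the estimator. -/
lemma IsAdmissible.abs_inner_sub_le (hB : B.IsAdmissible) (hd : 0 < d) {lam : ℝ}
    (hlam : 0 < lam) {t : ℕ} (ht : t ≤ B.T) {θbar : Feat d}
    (hmin : ∀ θ, B.loss (B.κ * lam) π y t θbar ≤ B.loss (B.κ * lam) π y t θ)
    (hnoise : ∀ v : Fin d → ℝ, v ⬝ᵥ B.noiseSum π y t ≤
      B.κ * Real.sqrt lam * Real.sqrt (v ⬝ᵥ B.V 1 π t *ᵥ v))
    {s : ℕ} (hs : s < t) (i : Fin N) :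
    |inner ℝ (B.x π s i) (θbar - B.θstar)| ≤ B.D + 1 := by
  have hκ := hB.kappa_pos
  have hD := hB.D_pos
  set Δ := θbar - B.θstar with hΔ
  by_contra hcon
  obtain ⟨⟨s₀, i₀⟩, hmem, hmax⟩ := Finset.exists_max_image (Finset.range t ×ˢ Finset.univ)
    (fun q : ℕ × Fin N => |inner ℝ (B.x π q.1 q.2) Δ|)
    ⟨(s, i), by simpa using hs⟩
  have hs₀ : s₀ < t := by simpa using hmem
  set a := |inner ℝ (B.x π s₀ i₀) Δ| with ha
  have hle : ∀ r < t, ∀ j, |inner ℝ (B.x π r j) Δ| ≤ a := fun r hr j =>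
    hmax (r, j) (by simpa using hr)
  have haD : B.D + 1 < a := (not_le.1 hcon).trans_le (hle s hs i)
  have ha0 : 0 < a := by linarith
  -- the point of the segment at which the largest deviation seen by a feature is exactly `D + 1`
  set γ := (B.D + 1) / a with hγdef
  have hγ0 : 0 < γ := by positivity
  have hγ1 : γ ≤ 1 := (div_le_one ha0).2 haD.le
  have hγa : γ * a = B.D + 1 := div_mul_cancel₀ _ ha0.ne'
  have hmain := hB.kappa_mul_quadratic_le hd hlam ht hmin hγ0.le hγ1 fun r hr j => by
    rw [abs_mul, abs_of_pos hγ0, ← hγa]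
    exact mul_le_mul_of_nonneg_left (hle r hr j) hγ0.le
  have hn := hnoise (γ • Δ).ofLp
  rw [dotProduct_V_mulVec_ofLp, one_mul] at hn
  rw [← hΔ] at hmain
  set A := ∑ s ∈ Finset.range t, ∑ i, (inner ℝ (B.x π s i) (γ • Δ)) ^ 2 with hA
  set b := ‖γ • Δ‖ with hb
  have hv : |inner ℝ (B.x π s₀ i₀) (γ • Δ)| = B.D + 1 := by
    rw [inner_smul_right, abs_mul, abs_of_pos hγ0, ← ha, hγa]
  have hAE : (B.D + 1) ^ 2 ≤ A := by
    rw [← hv, sq_abs]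
    refine le_trans ?_ (Finset.single_le_sum (f := fun s => ∑ i,
      (inner ℝ (B.x π s i) (γ • Δ)) ^ 2) (fun r _ => Finset.sum_nonneg fun j _ => sq_nonneg _)
      (Finset.mem_range.2 hs₀))
    exact Finset.single_le_sum (f := fun i => (inner ℝ (B.x π s₀ i) (γ • Δ)) ^ 2)
      (fun j _ => sq_nonneg _) (Finset.mem_univ i₀)
  have hbE : B.D + 1 ≤ b := by
    rw [← hv]
    refine (abs_real_inner_le_norm _ _).trans ?_
    exact mul_le_of_le_one_left (norm_nonneg _) (hB.norm_x_le π (hs₀.trans_le ht) i₀)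
  have h1 : B.κ * (A + lam * b ^ 2 - lam * B.D * b) ≤
      B.κ * (Real.sqrt lam * Real.sqrt (A + b ^ 2)) := by linarith
  exact (sqrt_mul_sqrt_lt hD hlam hAE hbE).not_ge (le_of_mul_le_mul_left h1 hκ)

/-- The confidence ellipsoid: the estimation error in the norm of `V_t`. -/
lemma IsAdmissible.sqrt_quadratic_sub_le (hB : B.IsAdmissible) (hd : 0 < d) {lam β : ℝ}
    (hlam : 0 < lam) {t : ℕ} (ht : t ≤ B.T) {θbar : Feat d}
    (hmin : ∀ θ, B.loss (B.κ * lam) π y t θbar ≤ B.loss (B.κ * lam) π y t θ)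
    (hnoise : ∀ v : Fin d → ℝ, v ⬝ᵥ B.noiseSum π y t ≤
      B.κ * Real.sqrt lam * Real.sqrt (v ⬝ᵥ B.V 1 π t *ᵥ v)) (hβ : 0 ≤ β)
    (hnoise' : ∀ v : Fin d → ℝ, v ⬝ᵥ B.noiseSum π y t ≤
      β * Real.sqrt (v ⬝ᵥ B.V lam π t *ᵥ v)) :
    Real.sqrt ((θbar - B.θstar).ofLp ⬝ᵥ B.V lam π t *ᵥ (θbar - B.θstar).ofLp) ≤
      (β + B.κ * B.D * Real.sqrt lam) / B.κ := by
  have hκ := hB.kappa_pos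
  have hD := hB.D_pos
  have hmain := hB.kappa_mul_quadratic_le hd hlam ht hmin zero_le_one le_rfl fun s hs i => by
    rw [one_mul]; exact hB.abs_inner_sub_le hd hlam ht hmin hnoise hs i
  rw [one_smul] at hmain
  set Δ := θbar - B.θstar with hΔ
  have hn := hnoise' Δ.ofLp
  rw [dotProduct_V_mulVec_ofLp] at hn ⊢
  set Q := (∑ s ∈ Finset.range t, ∑ i, (inner ℝ (B.x π s i) Δ) ^ 2) + lam * ‖Δ‖ ^ 2 with hQ
  have hS : 0 ≤ ∑ s ∈ Finset.range t, ∑ i, (inner ℝ (B.x π s i) Δ) ^ 2 :=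
    Finset.sum_nonneg fun s _ => Finset.sum_nonneg fun i _ => sq_nonneg _
  have hQ0 : 0 ≤ Q := by positivity
  have h1 : Real.sqrt lam * ‖Δ‖ ≤ Real.sqrt Q := by
    refine Real.le_sqrt_of_sq_le ?_
    rw [mul_pow, Real.sq_sqrt hlam.le]
    linarith
  have h2 : B.κ * lam * B.D * ‖Δ‖ ≤ B.κ * B.D * Real.sqrt lam * Real.sqrt Q := by
    calc B.κ * lam * B.D * ‖Δ‖ = B.κ * B.D * Real.sqrt lam * (Real.sqrt lam * ‖Δ‖) := by
          nth_rewrite 1 [← Real.mul_self_sqrt hlam.le]; ring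
      _ ≤ _ := mul_le_mul_of_nonneg_left h1 (by positivity)
  have h3 : B.κ * (Real.sqrt Q * Real.sqrt Q) ≤
      (β + B.κ * B.D * Real.sqrt lam) * Real.sqrt Q := by
    rw [Real.mul_self_sqrt hQ0]; linarith
  rw [le_div_iff₀ hκ]
  rcases (Real.sqrt_nonneg Q).eq_or_lt with h0 | h0
  · rw [← h0, zero_mul]; positivity
  · exact le_of_mul_le_mul_right (by linarith) h0

/-! ### Optimism -/

lemma abs_inner_le_wnorm_mul {W : Matrix (Fin d) (Fin d) ℝ} (hW : W.PosDef) (u v : Feat d) :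
    |inner ℝ u v| ≤ wnorm W⁻¹ u * Real.sqrt (v.ofLp ⬝ᵥ W *ᵥ v.ofLp) := by
  have h0 : 0 ≤ u.ofLp ⬝ᵥ W⁻¹ *ᵥ u.ofLp := by
    simpa using hW.inv.posSemidef.dotProduct_mulVec_nonneg u.ofLp
  rw [wnorm, ← Real.sqrt_mul h0, inner_eq_dotProduct]
  exact Real.abs_le_sqrt (sq_dotProduct_le_inv_mul hW _ _)

/-- The objective is Lipschitz in the mean feedback of the users. -/
lemma IsAdmissible.abs_f_sub_le (hB : B.IsAdmissible) (t : ℕ) (a : Alloc N K) (θ θ' : Feat d)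
    {w : Fin N → ℝ} (hw : ∀ i, B.Lr * |B.μ (inner ℝ (B.φ t i (a i)) θ) -
      B.μ (inner ℝ (B.φ t i (a i)) θ')| ≤ w i) :
    |B.f t a θ - B.f t a θ'| ≤ ∑ i, w i := by
  have h1 : ∀ k : Fin K, |B.r (∑ i with a i = k, B.μ (inner ℝ (B.φ t i k) θ)) -
      B.r (∑ i with a i = k, B.μ (inner ℝ (B.φ t i k) θ'))| ≤ ∑ i with a i = k, w i := by
    intro k
    have h2 := hB.r_lipschitz.dist_le_mul
      (∑ i with a i = k, B.μ (inner ℝ (B.φ t i k) θ))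
      (Set.mem_Ici.2 (Finset.sum_nonneg fun i _ => hB.mu_nonneg _))
      (∑ i with a i = k, B.μ (inner ℝ (B.φ t i k) θ'))
      (Set.mem_Ici.2 (Finset.sum_nonneg fun i _ => hB.mu_nonneg _))
    rw [Real.dist_eq, Real.dist_eq, ← Finset.sum_sub_distrib] at h2
    refine h2.trans ((mul_le_mul_of_nonneg_left (Finset.abs_sum_le_sum_abs _ _)
      B.Lr.coe_nonneg).trans ?_)
    rw [Finset.mul_sum]
    refine Finset.sum_le_sum fun i hi => ?_
    have := hw i
    rwa [(Finset.mem_filter.1 hi).2] at this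
  rw [f, f, ← Finset.sum_sub_distrib]
  refine (Finset.abs_sum_le_sum_abs _ _).trans ((Finset.sum_le_sum fun k _ => h1 k).trans ?_)
  exact (Finset.sum_fiberwise Finset.univ a w).le

/-- The regret of one round is at most twice the exploration bonus of the chosen allocation. -/
lemma mul_iSup_f_sub_le [Nonempty (Fin K)] (B : Problem N K d) {t : ℕ} {α c : ℝ} (hα0 : 0 < α)
    (w : Fin N → Fin K → ℝ) {θbar : Feat d} {a : Alloc N K}
    (horacle : IsOracleAnswer B.r α (fun i k => B.μ (inner ℝ (B.φ t i k) θbar))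
      (fun i k => c * w i k) a)
    (hconf : ∀ a' : Alloc N K, |B.f t a' θbar - B.f t a' B.θstar| ≤ ∑ i, c * w i (a' i)) :
    α * (⨆ a' : Alloc N K, B.f t a' B.θstar) - B.f t a B.θstar ≤ 2 * c * ∑ i, w i (a i) := by
  have h1 : (⨆ a' : Alloc N K, B.f t a' B.θstar) ≤ ⨆ a' : Alloc N K,
      oracleObjective B.r (fun i k => B.μ (inner ℝ (B.φ t i k) θbar)) (fun i k => c * w i k) a' :=
    ciSup_mono (Set.finite_range _).bddAbove fun a' => by
      have := (abs_le.1 (hconf a')).1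
      simp only [oracleObjective]
      rw [f] at this
      linarith
  have h2 := (mul_le_mul_of_nonneg_left h1 hα0.le).trans horacle
  have h3 := (abs_le.1 (hconf a)).2
  have h4 : oracleObjective B.r (fun i k => B.μ (inner ℝ (B.φ t i k) θbar))
      (fun i k => c * w i k) a = B.f t a θbar + ∑ i, c * w i (a i) := rfl
  rw [h4] at h2
  have h5 : ∑ i, c * w i (a i) = c * ∑ i, w i (a i) := by rw [Finset.mul_sum]
  rw [h5] at h2 h3
  linarith

/-! ### The elliptical potential with batched updates -/

lemma wnorm_inv_V_le (B : Problem N K d) {lam : ℝ} (hlam : 0 < lam) (π : ℕ → Alloc N K) (t : ℕ)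
    {u : Feat d} (hu : ‖u‖ ≤ 1) : wnorm (B.V lam π t)⁻¹ u ≤ 1 / Real.sqrt lam := by
  have hW := B.posDef_V π hlam t
  have hdet : IsUnit (B.V lam π t).det := (Matrix.isUnit_iff_isUnit_det _).1 hW.isUnit
  set W := B.V lam π t
  set v : Feat d := WithLp.toLp 2 (W⁻¹ *ᵥ u.ofLp) with hv
  have h1 : W *ᵥ v.ofLp = u.ofLp := by
    rw [hv, mulVec_mulVec, mul_nonsing_inv _ hdet, one_mulVec]
  have h2 := dotProduct_V_mulVec_ofLp B lam π t v
  have h3 : v.ofLp ⬝ᵥ W *ᵥ v.ofLp = inner ℝ u v := by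
    rw [h1, inner_eq_dotProduct, dotProduct_comm]
  rw [show B.V lam π t = W from rfl, h3] at h2
  have h4 : 0 ≤ ∑ s ∈ Finset.range t, ∑ i, (inner ℝ (B.x π s i) v) ^ 2 :=
    Finset.sum_nonneg fun s _ => Finset.sum_nonneg fun i _ => sq_nonneg _
  have h5 : inner ℝ u v ≤ ‖v‖ :=
    (real_inner_le_norm u v).trans (mul_le_of_le_one_left (norm_nonneg _) hu)
  have h6 : wnorm W⁻¹ u = Real.sqrt (inner ℝ u v) := by rw [wnorm, inner_eq_dotProduct]
  have h7 : 0 ≤ inner ℝ u v := by rw [h2]; positivity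
  rw [h6, one_div, ← Real.sqrt_inv]
  refine Real.sqrt_le_sqrt ?_
  rw [← one_div, le_div_iff₀ hlam]
  rcases h7.eq_or_lt with h0 | h0
  · rw [← h0]; linarith
  · have h8 : inner ℝ u v * (inner ℝ u v * lam) ≤ inner ℝ u v * 1 := by
      have := pow_le_pow_left₀ h7 h5 2
      nlinarith
    exact le_of_mul_le_mul_left h8 h0

/-- The potential argument when the design matrix is updated only once per round. A round either has
`∑_i ‖x_t(i)‖² ≤ 1` in the norm of `V_t⁻¹`, and is charged as usual, or it multiplies the determinant
of the design matrix by at least `2`, which happens in few rounds only. -/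
lemma IsAdmissible.sum_wnorm_le (hB : B.IsAdmissible) (hd : 0 < d) {lam : ℝ} (hlam : 0 < lam)
    (π : ℕ → Alloc N K) :
    ∑ t ∈ Finset.range B.T, ∑ i, wnorm (B.V lam π t)⁻¹ (B.x π t i) ≤
      Real.sqrt (2 * d * N * B.T * Real.log (1 + N * B.T / (d * lam))) +
        2 * d * N / Real.sqrt lam * Real.log (1 + N * B.T / (d * lam)) := by
  have hd' : (0 : ℝ) < d := by exact_mod_cast hd
  set L := Real.log (1 + N * B.T / (d * lam)) with hL
  set e : ℕ → ℝ := fun t => ∑ i, (B.x π t i).ofLp ⬝ᵥ (B.V lam π t)⁻¹ *ᵥ (B.x π t i).ofLp with he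
  have hterm : ∀ t i, 0 ≤ (B.x π t i).ofLp ⬝ᵥ (B.V lam π t)⁻¹ *ᵥ (B.x π t i).ofLp := fun t i => by
    simpa using (B.posDef_V π hlam t).inv.posSemidef.dotProduct_mulVec_nonneg (B.x π t i).ofLp
  have he0 : ∀ t, 0 ≤ e t := fun t => Finset.sum_nonneg fun i _ => hterm t i
  set g : ℕ → ℝ := fun t => Real.log (1 + e t) with hg
  have hg0 : ∀ t, 0 ≤ g t := fun t => Real.log_nonneg (by linarith [he0 t])
  have hsum : ∑ t ∈ Finset.range B.T, g t ≤ d * L := by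
    have h1 : ∀ t, g t ≤ Real.log (B.V lam π (t + 1)).det - Real.log (B.V lam π t).det := by
      intro t
      have hdet := (B.posDef_V π hlam t).det_pos
      have h2 := det_mul_one_add_sum_le (B.posDef_V π hlam t) fun i => (B.x π t i).ofLp
      rw [← B.V_succ] at h2
      have h3 := Real.log_le_log (mul_pos hdet (by have := he0 t; simp only [he] at this; linarith))
        h2
      rw [Real.log_mul hdet.ne' (by have := he0 t; simp only [he] at this; linarith)] at h3
      simp only [hg, he]
      linarith
    refine (Finset.sum_le_sum fun t _ => h1 t).trans ?_
    rw [Finset.sum_range_sub (fun t => Real.log (B.V lam π t).det), B.V_zero, det_smul, det_one,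
      mul_one, Fintype.card_fin]
    have h4 := Real.log_le_log (B.posDef_V π hlam B.T).det_pos (hB.det_V_le π hd hlam le_rfl)
    rw [Real.log_mul (by positivity) (by positivity), Real.log_pow (1 + _) d] at h4
    linarith
  have hround : ∀ t ∈ Finset.range B.T, ∑ i, wnorm (B.V lam π t)⁻¹ (B.x π t i) ≤
      Real.sqrt (2 * N * g t) + 2 * g t * (N / Real.sqrt lam) := by
    intro t ht
    have hN : ∑ i, wnorm (B.V lam π t)⁻¹ (B.x π t i) ≤ N / Real.sqrt lam := by
      refine (Finset.sum_le_sum fun i _ => B.wnorm_inv_V_le hlam π t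
        (hB.norm_x_le π (Finset.mem_range.1 ht) i)).trans (le_of_eq ?_)
      simp [div_eq_mul_inv]
    have hcs : ∑ i, wnorm (B.V lam π t)⁻¹ (B.x π t i) ≤ Real.sqrt (N * e t) := by
      refine Real.le_sqrt_of_sq_le ?_
      have h1 := sq_sum_le_card_mul_sum_sq (s := Finset.univ)
        (f := fun i => wnorm (B.V lam π t)⁻¹ (B.x π t i))
      simp only [wnorm, Real.sq_sqrt (hterm t _), Finset.card_univ, Fintype.card_fin] at h1
      exact h1
    have hfrac := Real.le_log_one_add_of_nonneg (he0 t)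
    rcases le_or_gt (e t) 1 with h1 | h1
    · have h2 : e t ≤ 2 * g t := by
        refine le_trans ?_ (mul_le_mul_of_nonneg_left hfrac zero_le_two)
        rw [mul_div_assoc', le_div_iff₀ (by linarith [he0 t])]
        nlinarith [he0 t]
      refine (hcs.trans (Real.sqrt_le_sqrt ?_)).trans (le_add_of_nonneg_right ?_)
      · nlinarith [mul_le_mul_of_nonneg_left h2 (Nat.cast_nonneg (α := ℝ) N)]
      · have := hg0 t; positivity
    · have h2 : 1 ≤ 2 * g t := by
        refine le_trans ?_ (mul_le_mul_of_nonneg_left hfrac zero_le_two)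
        rw [mul_div_assoc', le_div_iff₀ (by linarith)]
        linarith
      refine (hN.trans (le_mul_of_one_le_left (by positivity) h2)).trans
        (le_add_of_nonneg_left (Real.sqrt_nonneg _))
  refine (Finset.sum_le_sum hround).trans ?_
  rw [Finset.sum_add_distrib, ← Finset.sum_mul, ← Finset.mul_sum]
  refine add_le_add (Real.le_sqrt_of_sq_le ?_) ?_
  · refine sq_sum_le_card_mul_sum_sq.trans ?_
    have h1 : ∀ t, Real.sqrt (2 * N * g t) ^ 2 = 2 * N * g t := fun t =>
      Real.sq_sqrt (by have := hg0 t; positivity)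
    simp only [h1, ← Finset.mul_sum, Finset.card_range]
    calc (B.T : ℝ) * (2 * N * ∑ t ∈ Finset.range B.T, g t) ≤ B.T * (2 * N * (d * L)) := by gcongr
      _ = _ := by ring
  · calc 2 * (∑ t ∈ Finset.range B.T, g t) * (N / Real.sqrt lam) ≤
        2 * (d * L) * (N / Real.sqrt lam) := by gcongr
      _ = _ := by ring

end Problem

end CAB

/-! ### The regret bound with high probability -/

namespace CAB

open Matrix

variable {N K d : ℕ}

lemma Problem.IsAdmissible.lamMin_pos {B : Problem N K d} (hB : B.IsAdmissible) {δ : ℝ}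
    (hδ0 : 0 < δ) (hδ1 : δ < 1) : 0 < lamMin B δ := by
  have hκ := hB.kappa_pos
  have hσ := hB.sigma_pos
  have h1 : 0 < Real.log (1 / δ) := Real.log_pos (by rw [one_div]; exact (one_lt_inv₀ hδ0).2 hδ1)
  have h2 : 0 ≤ Real.log (1 + N * B.T / d) :=
    Real.log_nonneg (le_add_of_nonneg_right (by positivity))
  rw [lamMin]
  positivity

/-- The pathwise regret bound, on the event on which the noise is controlled both with unit
regularization and with the regularization of the algorithm. -/
lemma Problem.IsAdmissible.regret_le {B : Problem N K d} (hB : B.IsAdmissible) (hK : 0 < K)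
    (hd : 0 < d) {α δ lam0 : ℝ} (hα0 : 0 < α) (hδ0 : 0 < δ) (hδ1 : δ < 1)
    (hlam : lamMin B δ ≤ lam0) {π : ℕ → Alloc N K} {y : ℕ → Fin N → ℝ} {θbar : ℕ → Feat d}
    (hmle : ∀ t < B.T, ∀ θ : Feat d,
      B.loss (B.κ * lam0) π y t (θbar t) ≤ B.loss (B.κ * lam0) π y t θ)
    (horacle : ∀ t < B.T, IsOracleAnswer B.r α (fun i a => B.μ (inner ℝ (B.φ t i a) (θbar t)))
      (fun i a => explConst B lam0 δ * wnorm (B.V lam0 π t)⁻¹ (B.φ t i a)) (π t))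
    (hnoise1 : ∀ t ≤ B.T, ∀ v : Fin d → ℝ, v ⬝ᵥ B.noiseSum π y t ≤
      B.σ * Real.sqrt (d * Real.log (1 + N * B.T / (d * 1)) + 2 * Real.log (1 / δ)) *
        Real.sqrt (v ⬝ᵥ B.V 1 π t *ᵥ v))
    (hnoise2 : ∀ t ≤ B.T, ∀ v : Fin d → ℝ, v ⬝ᵥ B.noiseSum π y t ≤
      B.σ * Real.sqrt (d * Real.log (1 + N * B.T / (d * lam0)) + 2 * Real.log (1 / δ)) *
        Real.sqrt (v ⬝ᵥ B.V lam0 π t *ᵥ v)) :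
    B.regret α π ≤ 2 * explConst B lam0 δ *
      (Real.sqrt (2 * d * N * B.T * Real.log (1 + N * B.T / (d * lam0))) +
        2 * d * N / Real.sqrt lam0 * Real.log (1 + N * B.T / (d * lam0))) := by
  have hκ := hB.kappa_pos
  have hσ := hB.sigma_pos
  have hD := hB.D_pos
  have hlam0 : 0 < lam0 := (hB.lamMin_pos hδ0 hδ1).trans_le hlam
  have : Nonempty (Fin K) := ⟨⟨0, hK⟩⟩
  have hc0 : 0 ≤ explConst B lam0 δ := by rw [explConst]; positivity
  -- this is where the lower bound on the regularization enters
  have hβ1 : B.σ * Real.sqrt (d * Real.log (1 + N * B.T / (d * 1)) + 2 * Real.log (1 / δ)) ≤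
      B.κ * Real.sqrt lam0 := by
    have h1 : B.σ ^ 2 * (d * Real.log (1 + N * B.T / (d * 1)) + 2 * Real.log (1 / δ)) ≤
        B.κ ^ 2 * lam0 := by
      have h2 := mul_le_mul_of_nonneg_left hlam (sq_nonneg B.κ)
      rw [lamMin, ← mul_assoc, mul_div_cancel₀ _ (pow_ne_zero 2 hκ.ne')] at h2
      rwa [mul_one]
    have h3 := Real.sqrt_le_sqrt h1
    rwa [Real.sqrt_mul (sq_nonneg _), Real.sqrt_mul (sq_nonneg _), Real.sqrt_sq hσ.le,
      Real.sqrt_sq hκ.le] at h3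
  have hround : ∀ t ∈ Finset.range B.T,
      α * (⨆ π' : Alloc N K, B.f t π' B.θstar) - B.f t (π t) B.θstar ≤
        2 * explConst B lam0 δ * ∑ i, wnorm (B.V lam0 π t)⁻¹ (B.x π t i) := by
    intro t ht
    have ht' := Finset.mem_range.1 ht
    refine mul_iSup_f_sub_le B hα0 (fun i a => wnorm (B.V lam0 π t)⁻¹ (B.φ t i a))
      (horacle t ht') fun a' => hB.abs_f_sub_le t a' _ _ fun i => ?_
    have h1 := hB.sqrt_quadratic_sub_le hd hlam0 ht'.le (hmle t ht')
      (fun v => (hnoise1 t ht'.le v).trans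
        (mul_le_mul_of_nonneg_right hβ1 (Real.sqrt_nonneg _)))
      (mul_nonneg hσ.le (Real.sqrt_nonneg _)) (hnoise2 t ht'.le)
    have h2 := abs_inner_le_wnorm_mul (B.posDef_V π hlam0 t) (B.φ t i (a' i)) (θbar t - B.θstar)
    have h3 := hB.mu_lipschitz.dist_le_mul (inner ℝ (B.φ t i (a' i)) (θbar t))
      (inner ℝ (B.φ t i (a' i)) B.θstar)
    rw [Real.dist_eq, Real.dist_eq, ← inner_sub_right] at h3
    have hw0 : 0 ≤ wnorm (B.V lam0 π t)⁻¹ (B.φ t i (a' i)) := Real.sqrt_nonneg _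
    have h4 := h3.trans (mul_le_mul_of_nonneg_left
      (h2.trans (mul_le_mul_of_nonneg_left h1 hw0)) B.Lμ.coe_nonneg)
    refine (mul_le_mul_of_nonneg_left h4 B.Lr.coe_nonneg).trans (le_of_eq ?_)
    rw [explConst]
    ring
  refine (Finset.sum_le_sum hround).trans ?_
  rw [← Finset.mul_sum]
  exact mul_le_mul_of_nonneg_left (hB.sum_wnorm_le hd hlam0 π) (by positivity)

theorem IsUCBRun.one_sub_le_measureReal_regret_le {B : Problem N K d} (hB : B.IsAdmissible)
    (hK : 0 < K) (hd : 0 < d) {α δ lam0 : ℝ} (hα0 : 0 < α) (hδ0 : 0 < δ) (hδ1 : δ < 1)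
    (hlam : lamMin B δ ≤ lam0) {Ω : Type*} [MeasurableSpace Ω] {P : Measure Ω}
    [IsProbabilityMeasure P] {π : ℕ → Ω → Alloc N K} {y : ℕ → Fin N → Ω → ℝ}
    {θbar : ℕ → Ω → Feat d} (h : IsUCBRun B lam0 (explConst B lam0 δ) α P π y θbar) :
    1 - 2 * δ ≤ P.real {ω | B.regret α (fun t => π t ω) ≤ 2 * explConst B lam0 δ *
      (Real.sqrt (2 * d * N * B.T * Real.log (1 + N * B.T / (d * lam0))) +
        2 * d * N / Real.sqrt lam0 * Real.log (1 + N * B.T / (d * lam0)))} := by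
  have hlam0 : 0 < lam0 := (hB.lamMin_pos hδ0 hδ1).trans_le hlam
  have h1 := h.toIsFeedback.measure_noiseSum_gt_le hB hd one_pos hδ0
  have h2 := h.toIsFeedback.measure_noiseSum_gt_le hB hd hlam0 hδ0
  set E1 := {ω | ¬ ∀ t ≤ B.T, ∀ v : Fin d → ℝ,
    v ⬝ᵥ B.noiseSum (fun s => π s ω) (fun s i => y s i ω) t ≤
      B.σ * Real.sqrt (d * Real.log (1 + N * B.T / (d * 1)) + 2 * Real.log (1 / δ)) *
        Real.sqrt (v ⬝ᵥ B.V 1 (fun s => π s ω) t *ᵥ v)} with hE1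
  set E2 := {ω | ¬ ∀ t ≤ B.T, ∀ v : Fin d → ℝ,
    v ⬝ᵥ B.noiseSum (fun s => π s ω) (fun s i => y s i ω) t ≤
      B.σ * Real.sqrt (d * Real.log (1 + N * B.T / (d * lam0)) + 2 * Real.log (1 / δ)) *
        Real.sqrt (v ⬝ᵥ B.V lam0 (fun s => π s ω) t *ᵥ v)} with hE2
  set G := {ω | B.regret α (fun t => π t ω) ≤ 2 * explConst B lam0 δ *
      (Real.sqrt (2 * d * N * B.T * Real.log (1 + N * B.T / (d * lam0))) +
        2 * d * N / Real.sqrt lam0 * Real.log (1 + N * B.T / (d * lam0)))} with hG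
  have hcover : Set.univ ⊆ G ∪ (E1 ∪ E2) := by
    intro ω _
    by_cases hω1 : ω ∈ E1
    · exact Or.inr (Or.inl hω1)
    by_cases hω2 : ω ∈ E2
    · exact Or.inr (Or.inr hω2)
    refine Or.inl ?_
    exact hB.regret_le hK hd hα0 hδ0 hδ1 hlam (θbar := fun t => θbar t ω)
      (fun t ht => h.mle t ht ω) (fun t ht => h.oracle t ht ω) (not_not.1 hω1) (not_not.1 hω2)
  have h3 : P.real E1 ≤ δ := ENNReal.toReal_le_of_le_ofReal hδ0.le h1
  have h4 : P.real E2 ≤ δ := ENNReal.toReal_le_of_le_ofReal hδ0.le h2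
  have h5 : P.real Set.univ ≤ P.real G + (P.real E1 + P.real E2) :=
    (measureReal_mono hcover).trans ((measureReal_union_le _ _).trans
      (add_le_add_right (measureReal_union_le _ _) _))
  rw [probReal_univ] at h5
  linarith

/-! ### The rate for the least regularization -/

lemma log_one_add_mul_le {c x : ℝ} (hc : 1 ≤ c) (hx : 0 ≤ x) :
    Real.log (1 + c * x) ≤ c * Real.log (1 + x) := by
  rw [← Real.log_rpow (by linarith)]
  exact Real.log_le_log (by positivity) (one_add_mul_self_le_rpow_one_add (by linarith) hc)

/-- The explicit bound for the least regularization, with `n` for `N T` and `q` for `L_r L_μ`. The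
hypothesis `κ ≤ σ²` bounds the inverse of the regularization. -/
lemma explicit_bound_le_rate {σ D₀ D κ q n N d δ : ℝ} (hσ : 0 < σ) (hD₀ : 0 < D₀) (hD : D₀ ≤ D)
    (hκ : 0 < κ) (hκσ : κ ≤ σ ^ 2) (hq : 0 ≤ q) (hn : 1 ≤ n) (hN : 0 ≤ N) (hd : 1 ≤ d)
    (hδ0 : 0 < δ) (hδ1 : δ < 1) {lam : ℝ}
    (hlam : lam = σ ^ 2 / κ ^ 2 * (d * Real.log (1 + n / d) + 2 * Real.log (1 / δ))) :
    2 * (q / κ * (σ * Real.sqrt (d * Real.log (1 + n / (d * lam)) + 2 * Real.log (1 / δ)) +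
        κ * D * Real.sqrt lam)) *
      (Real.sqrt (2 * d * n * Real.log (1 + n / (d * lam))) +
        2 * d * N / Real.sqrt lam * Real.log (1 + n / (d * lam))) ≤
    (2 * σ * ((1 + 2 * σ ^ 2) / D₀ + 1) * (1 + 2 * σ ^ 2) * (6 + 2 * σ)) *
      Real.log (Real.exp 1 + n / δ) * (κ⁻¹ * q * D * (d * Real.sqrt n + d * N)) := by
  have hD' : 0 < D := hD₀.trans_le hD
  have hd0 : 0 < d := by linarith
  have hn0 : 0 < n := by linarith
  obtain ⟨A, hA⟩ : ∃ A, A = 1 + 2 * σ ^ 2 := ⟨_, rfl⟩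
  have hA1 : 1 ≤ A := by rw [hA]; nlinarith [sq_nonneg σ]
  obtain ⟨Λ, hΛ⟩ : ∃ Λ, Λ = Real.log (Real.exp 1 + n / δ) := ⟨_, rfl⟩
  obtain ⟨u, hu⟩ : ∃ u, u = Real.log (1 + n / d) := ⟨_, rfl⟩
  obtain ⟨w, hw⟩ : ∃ w, w = Real.log (1 / δ) := ⟨_, rfl⟩
  obtain ⟨L, hL⟩ : ∃ L, L = Real.log (1 + n / (d * lam)) := ⟨_, rfl⟩
  rw [← hu, ← hw] at hlam
  rw [← hL, ← hw, ← hΛ, ← hA]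
  obtain ⟨l, hl⟩ : ∃ l, l = d * u + 2 * w := ⟨_, rfl⟩
  rw [← hl] at hlam
  have hw0 : 0 ≤ w := by
    rw [hw]; exact Real.log_nonneg (by rw [one_div]; exact (one_le_inv₀ hδ0).2 hδ1.le)
  have hu0 : 0 ≤ u := by
    rw [hu]; exact Real.log_nonneg (le_add_of_nonneg_right (by positivity))
  have hl12 : 1 / 2 ≤ l := by
    have h1 := Real.le_log_one_add_of_nonneg (x := n / d) (by positivity)
    rw [← hu] at h1
    have h2 : 1 / 2 ≤ d * (2 * (n / d) / (n / d + 2)) := by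
      have : d * (2 * (n / d) / (n / d + 2)) = 2 * n * d / (n + 2 * d) := by field_simp
      rw [this, div_le_div_iff₀ (by norm_num) (by positivity)]
      nlinarith
    have h3 := mul_le_mul_of_nonneg_left h1 hd0.le
    rw [hl]; linarith
  have hl0 : 0 < l := by linarith
  have hlam0 : 0 < lam := by rw [hlam]; positivity
  -- `λ₀` may be smaller than `1`, but not smaller than `1 / A`
  have hLu : L ≤ A * u := by
    rw [hL, hu]
    refine (Real.log_le_log (by positivity) ?_).trans (log_one_add_mul_le hA1 (by positivity))
    have h1 : 1 ≤ A * lam := by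
      have h2 : 1 ≤ (2 * σ ^ 2) * lam := by
        rw [hlam, show 2 * σ ^ 2 * (σ ^ 2 / κ ^ 2 * l) = (2 * l) * ((σ ^ 2) ^ 2 / κ ^ 2) by ring]
        have h3 : 1 ≤ (σ ^ 2) ^ 2 / κ ^ 2 := by
          rw [one_le_div (by positivity)]
          exact pow_le_pow_left₀ hκ.le hκσ 2
        exact one_le_mul_of_one_le_of_one_le (by linarith) h3
      rw [hA]; linarith
    have h2 : n / (d * lam) ≤ A * (n / d) := by
      rw [div_le_iff₀ (by positivity)]
      have : A * (n / d) * (d * lam) = n * (A * lam) := by field_simp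
      rw [this]
      exact le_mul_of_one_le_right hn0.le h1
    linarith
  have hL0 : 0 ≤ L := by
    rw [hL]; exact Real.log_nonneg (le_add_of_nonneg_right (by positivity))
  have hnδ : n ≤ n / δ := by exact le_div_self hn0.le hδ0 hδ1.le
  have he : 1 ≤ Real.exp 1 := Real.one_le_exp zero_le_one
  have huΛ : u ≤ Λ := by
    rw [hu, hΛ]
    refine Real.log_le_log (by positivity) ?_
    have : n / d ≤ n := div_le_self hn0.le hd
    linarith
  have hwΛ : w ≤ Λ := by
    rw [hw, hΛ]
    refine Real.log_le_log (by positivity) ?_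
    have : 1 / δ ≤ n / δ := div_le_div_of_nonneg_right hn hδ0.le
    linarith
  have hΛ0 : 0 ≤ Λ := hu0.trans huΛ
  have hlΛ : l ≤ 3 * d * Λ := by
    have h1 := mul_le_mul_of_nonneg_left huΛ hd0.le
    have h2 := mul_le_mul_of_nonneg_right hd hΛ0
    rw [hl]; linarith
  have hsl : Real.sqrt lam = σ / κ * Real.sqrt l := by
    rw [hlam, Real.sqrt_mul (by positivity), ← div_pow, Real.sqrt_sq (by positivity)]
  have hsl0 : 0 < Real.sqrt l := Real.sqrt_pos.2 hl0
  -- the exploration constant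
  have hc : σ * Real.sqrt (d * L + 2 * w) + κ * D * Real.sqrt lam ≤
      σ * D * (A / D₀ + 1) * Real.sqrt l := by
    have h1 : Real.sqrt (d * L + 2 * w) ≤ A * Real.sqrt l := by
      rw [← Real.sqrt_sq (zero_le_one.trans hA1), ← Real.sqrt_mul (sq_nonneg _)]
      refine Real.sqrt_le_sqrt ?_
      have h2 : d * L + 2 * w ≤ A * l := by
        have h3 := mul_le_mul_of_nonneg_left hLu hd0.le
        have h4 := mul_le_mul_of_nonneg_right hA1 hw0
        rw [hl]; linarith
      have h5 : A * l ≤ A ^ 2 * l :=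
        mul_le_mul_of_nonneg_right (le_self_pow₀ hA1 two_ne_zero) hl0.le
      exact h2.trans h5
    have h2 : κ * D * Real.sqrt lam = σ * D * Real.sqrt l := by rw [hsl]; field_simp
    have h3 : A ≤ D * (A / D₀) := by
      rw [mul_div_assoc', le_div_iff₀ hD₀, mul_comm]
      exact mul_le_mul_of_nonneg_right hD (by linarith)
    rw [h2]
    calc σ * Real.sqrt (d * L + 2 * w) + σ * D * Real.sqrt l
        ≤ σ * (D * (A / D₀) * Real.sqrt l) + σ * D * Real.sqrt l := by
          gcongr
          exact h1.trans (mul_le_mul_of_nonneg_right h3 hsl0.le)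
      _ = _ := by ring
  have hb1 : Real.sqrt l * Real.sqrt (2 * d * n * L) ≤ 6 * A * Λ * (d * Real.sqrt n) := by
    rw [← Real.sqrt_mul hl0.le]
    refine Real.sqrt_le_iff.2 ⟨by positivity, ?_⟩
    calc l * (2 * d * n * L) ≤ (3 * d * Λ) * (2 * d * n * (A * Λ)) := by
          gcongr
          exact hLu.trans (mul_le_mul_of_nonneg_left huΛ (by linarith))
      _ = 6 * A * 1 * (Λ * d) ^ 2 * n := by ring
      _ ≤ 6 * A * (6 * A) * (Λ * d) ^ 2 * n := by gcongr; linarith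
      _ = (6 * A * Λ * (d * Real.sqrt n)) ^ 2 := by
          simp only [mul_pow, Real.sq_sqrt hn0.le]; ring
  have hb2 : Real.sqrt l * (2 * d * N / Real.sqrt lam * L) ≤ 2 * σ * A * Λ * (d * N) := by
    have h1 : Real.sqrt l * (2 * d * N / Real.sqrt lam * L) = 2 * (d * N) * (κ / σ) * L := by
      rw [hsl]; field_simp
    have h2 : κ / σ ≤ σ := by rw [div_le_iff₀ hσ, ← sq]; exact hκσ
    rw [h1]
    calc 2 * (d * N) * (κ / σ) * L ≤ 2 * (d * N) * σ * (A * Λ) := by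
          gcongr
          exact hLu.trans (mul_le_mul_of_nonneg_left huΛ (by linarith))
      _ = _ := by ring
  set X := Real.sqrt (2 * d * n * L) + 2 * d * N / Real.sqrt lam * L with hX
  have hX0 : 0 ≤ X := by positivity
  have hX1 : Real.sqrt l * X ≤ A * (6 + 2 * σ) * Λ * (d * Real.sqrt n + d * N) := by
    rw [hX, mul_add]
    have h1 : 0 ≤ 2 * σ * A * Λ * (d * Real.sqrt n) := by positivity
    have h2 : 0 ≤ 6 * A * Λ * (d * N) := by positivity
    linarith
  have hH0 : 0 ≤ σ * D * (A / D₀ + 1) := by positivity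
  calc 2 * (q / κ * (σ * Real.sqrt (d * L + 2 * w) + κ * D * Real.sqrt lam)) * X
      ≤ 2 * (q / κ * (σ * D * (A / D₀ + 1) * Real.sqrt l)) * X := by gcongr
    _ = 2 * (q / κ) * (σ * D * (A / D₀ + 1)) * (Real.sqrt l * X) := by ring
    _ ≤ 2 * (q / κ) * (σ * D * (A / D₀ + 1)) *
        (A * (6 + 2 * σ) * Λ * (d * Real.sqrt n + d * N)) := by gcongr
    _ = _ := by ring

/-- The curvature of the link function is at most the sub-Gaussian variance proxy of the noise, as
soon as there is one round. -/
lemma IsFeedback.kappa_le_sq {B : Problem N K d} (hB : B.IsAdmissible) (hN : 0 < N) (hd : 0 < d)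
    (hT : 0 < B.T) {Ω : Type*} [MeasurableSpace Ω] {P : Measure Ω} [IsProbabilityMeasure P]
    {π : ℕ → Ω → Alloc N K} {y : ℕ → Fin N → Ω → ℝ} (h : IsFeedback B P π y) :
    B.κ ≤ B.σ ^ 2 := by
  obtain ⟨a, ha⟩ : ∃ a, P (π 0 ⁻¹' {a}) ≠ 0 := by
    by_contra hcon
    push Not at hcon
    have h1 : P (⋃ a, π 0 ⁻¹' {a}) = 0 := measure_iUnion_null hcon
    have h2 : (⋃ a, π 0 ⁻¹' {a}) = Set.univ := by ext ω; simp
    rw [h2, measure_univ] at h1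
    exact one_ne_zero h1
  refine hB.kappa_le_sq_of_cgf_le hd (z := inner ℝ (B.φ 0 ⟨0, hN⟩ (a ⟨0, hN⟩)) B.θstar) ?_
    fun ξ => h.cgf_le hB hT ha ⟨0, hN⟩ ξ
  exact (abs_real_inner_le_norm _ _).trans
    (mul_le_of_le_one_left (norm_nonneg _) (hB.context_norm_le 0 hT _ _))

theorem IsUCBRun.one_sub_le_measureReal_regret_le_rate {B : Problem N K d} (hB : B.IsAdmissible)
    (hN : 0 < N) (hK : 0 < K) (hd : 0 < d) {D₀ : ℝ} (hD₀ : 0 < D₀) (hD : D₀ ≤ B.D) {α δ : ℝ}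
    (hα0 : 0 < α) (hδ0 : 0 < δ) (hδ1 : δ < 1) {Ω : Type*} [MeasurableSpace Ω] {P : Measure Ω}
    [IsProbabilityMeasure P] {π : ℕ → Ω → Alloc N K} {y : ℕ → Fin N → Ω → ℝ}
    {θbar : ℕ → Ω → Feat d}
    (h : IsUCBRun B (lamMin B δ) (explConst B (lamMin B δ) δ) α P π y θbar) :
    1 - 2 * δ ≤ P.real {ω | B.regret α (fun t => π t ω) ≤
      (2 * B.σ * ((1 + 2 * B.σ ^ 2) / D₀ + 1) * (1 + 2 * B.σ ^ 2) * (6 + 2 * B.σ)) *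
        (Real.log (Real.exp 1 + N * B.T / δ)) ^ 1 *
          ((B.κ)⁻¹ * B.Lr * B.Lμ * B.D * (d * Real.sqrt (N * B.T) + d * N))} := by
  have hκ := hB.kappa_pos
  have hσ := hB.sigma_pos
  have hBD := hB.D_pos
  rcases Nat.eq_zero_or_pos B.T with hT | hT
  · have hE : 0 ≤ Real.log (Real.exp 1 + N * B.T / δ) :=
      Real.log_nonneg (by
        have := Real.one_le_exp (zero_le_one (α := ℝ))
        have : 0 ≤ N * B.T / δ := by positivity
        linarith)
    rw [show {ω | B.regret α (fun t => π t ω) ≤ _} = Set.univ from Set.eq_univ_of_forall fun ω => by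
      have h0 : B.regret α (fun t => π t ω) = 0 := by simp [Problem.regret, hT]
      change B.regret α (fun t => π t ω) ≤ _
      rw [h0]
      positivity, probReal_univ]
    linarith
  · -- there is a round, so that `κ ≤ σ²` is available
    refine (h.one_sub_le_measureReal_regret_le hB hK hd hα0 hδ0 hδ1 le_rfl).trans
      (measureReal_mono (Set.ofPred_subset_ofPred.2 fun ω hω => le_trans hω ?_))
    have hNT : (1 : ℝ) ≤ N * B.T := by exact_mod_cast Nat.mul_pos hN hT
    have h1 := explicit_bound_le_rate (q := B.Lr * B.Lμ) (n := N * B.T) (N := N) (d := d) hσ hD₀ hD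
      hκ (h.toIsFeedback.kappa_le_sq hB hN hd hT) (by positivity) hNT (Nat.cast_nonneg _)
      (by exact_mod_cast hd) hδ0 hδ1 (lam := lamMin B δ) rfl
    rw [← mul_assoc (2 * (d : ℝ)), ← mul_assoc (B.κ)⁻¹] at h1
    rw [pow_one]
    exact h1

end CAB

theorem mainTheorem1 :
    -- the explicit bound
    (∀ (N K d : ℕ), 0 < N → 0 < K → 0 < d →
      ∀ (B : CAB.Problem N K d), B.IsAdmissible →
      ∀ (α δ lam0 : ℝ), 0 < α → α ≤ 1 → 0 < δ → δ < 1 → CAB.lamMin B δ ≤ lam0 →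
      ∀ (Ω : Type*) [MeasurableSpace Ω] (P : Measure Ω) [IsProbabilityMeasure P]
        (π : ℕ → Ω → CAB.Alloc N K) (y : ℕ → Fin N → Ω → ℝ) (θbar : ℕ → Ω → CAB.Feat d),
        CAB.IsUCBRun B lam0 (CAB.explConst B lam0 δ) α P π y θbar →
        1 - 2 * δ ≤ P.real {ω | B.regret α (fun t => π t ω) ≤
          2 * CAB.explConst B lam0 δ *
            (Real.sqrt (2 * d * N * B.T * Real.log (1 + N * B.T / (d * lam0))) +
              2 * d * N / Real.sqrt lam0 * Real.log (1 + N * B.T / (d * lam0)))}) ∧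
    -- the rate, for the least admissible regularization; the constant and the power of the
    -- logarithm depend only on `σ` and on a positive lower bound for `D`
    (∀ (σ D₀ : ℝ), 0 < σ → 0 < D₀ → ∃ (C : ℝ) (p : ℕ), 0 < C ∧
      ∀ (N K d : ℕ), 0 < N → 0 < K → 0 < d →
      ∀ (B : CAB.Problem N K d), B.IsAdmissible → B.σ = σ → D₀ ≤ B.D →
      ∀ (α δ : ℝ), 0 < α → α ≤ 1 → 0 < δ → δ < 1 →
      ∀ (Ω : Type*) [MeasurableSpace Ω] (P : Measure Ω) [IsProbabilityMeasure P]
        (π : ℕ → Ω → CAB.Alloc N K) (y : ℕ → Fin N → Ω → ℝ) (θbar : ℕ → Ω → CAB.Feat d),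
        CAB.IsUCBRun B (CAB.lamMin B δ) (CAB.explConst B (CAB.lamMin B δ) δ) α P π y θbar →
        1 - 2 * δ ≤ P.real {ω | B.regret α (fun t => π t ω) ≤
          C * (Real.log (Real.exp 1 + N * B.T / δ)) ^ p *
            ((B.κ)⁻¹ * B.Lr * B.Lμ * B.D * (d * Real.sqrt (N * B.T) + d * N))}) := by
  refine ⟨?_, ?_⟩
  · intro N K d _ hK hd B hB α δ lam0 hα0 _ hδ0 hδ1 hlam Ω _ P _ π y θbar h
    exact h.one_sub_le_measureReal_regret_le hB hK hd hα0 hδ0 hδ1 hlam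
  · intro σ D₀ hσ hD₀
    refine ⟨2 * σ * ((1 + 2 * σ ^ 2) / D₀ + 1) * (1 + 2 * σ ^ 2) * (6 + 2 * σ), 1, by positivity, ?_⟩
    intro N K d hN hK hd B hB hBσ hD α δ hα0 _ hδ0 hδ1 Ω _ P _ π y θbar h
    rw [← hBσ]
    exact h.one_sub_le_measureReal_regret_le_rate hB hN hK hd hD₀ hD hα0 hδ0 hδ1
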